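/- **Theorem (sharp mean regression discontinuity design).** Let $(Y,X)$ be a real random vector on a probability space $(\Omega^x,\mathcal F^x,\mathbb P^x)$ and fix a regular conditional distribution of $Y$ given $X$; $E[\,\cdot\,|X=x]$ and $V(Y|X=x)$ are computed from it. (The treatment is $D=\mathbf 1\{X\ge 0\}$.) Let $r_2(u)=(1,u,u^2)'$, $e_0=(1,0,0)'$, $\delta_i^+=\mathbf 1\{X_i\ge0\}$, $\delta_i^-=\mathbf 1\{X_i\le 0\}$, and $\Gamma_2^\pm=\int_{\mathbb R_\pm}K(u)r_2(u)r_2(u)'du$. Assume: * **S.** $(Y_i,X_i)$, $i\ge1$, are independent copies of $(Y,X)$; $X$ has a density $f_X$ that is continuously differentiable on an interval $[\underline x,\overline x]$ with $\underline x<0<\overline x$, and $0<f_X(0)<\infty$. * **K.** $K:[-1,1]\to[0,\infty)$ (extended by $0$ to $\mathbb R$) is bounded and continuous on $[-1,1]$; $\{K(\cdot/h):h>0\}$ is of VC type, that is, it has a measurable envelope $F$, and there are $A,V\ge1$ such that for every probability measure $Q$ on $\mathbb R$ and every $0<\varepsilon\le1$ it is covered by at most $(A/\varepsilon)^V$ closed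 $L^2(Q)$-balls of radius $\varepsilon\|F\|_{Q,2}$ centred in the class; $\Gamma_2^+$ and $\Gamma_2^-$ are positive definite. * **M.** $(\xi_i)_{i\ge1}$ are independent standard normal variables on a probability space $(\Omega^\xi,\mathcal F^\xi,\mathbb P^\xi)$; data and multipliers are combined on the product space. * **SMRD.** (i) For some $\epsilon>0$, $E[|Y|^{2+\epsilon}|X=x]$ is finite for every $x\in[\underline x,\overline x]\setminus\{0\}$ and bounded on a punctured neighbourhood of $0$; $\frac{\partial^j}{\partial x^j}E[Y|X=x]$ exists and is Lipschitz on $[\underline x,0)$ and on $(0,\overline x]$ for $j=0,1,2,3$. (ii) The bandwidths $h_n>0$ satisfy $h_n\to0$, $nh_n^7\to0$, $nh_n^2\to\infty$. (iii) $V(Y|X=\cdot)$ is continuously differentiable on $[\underline x,\overline x]\setminus\{0\}$ with bounded derivative, and its one-sided limits at $0$ satisfy $0<V(Y|X=0^\pm)<\infty$. Let $\hat\alpha_\pm$ be (any measurable choice of) a minimizer over $\alpha\in\mathbb R^3$ of $$\sum_{i=1}^n\delta_i^\pm\Big(Y_i-r_2(X_i/h_n)'\alpha\Big)^2K(X_i/h_n),$$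 let $\hat\mu(0^\pm)=e_0'\hat\alpha_\pm$, $\hat\tau_{SMRD}=\hat\mu(0^+)-\hat\mu(0^-)$ and $\tilde\mu(x)=r_2(x/h_n)'\hat\alpha_+\mathbf 1\{x\ge0\}+r_2(x/h_n)'\hat\alpha_-\mathbf 1\{x\le0\}$. Given estimators $\hat f_X(0)$ of $f_X(0)$ put $$\hat\nu^\pm_{\xi,n}=\sum_{i=1}^n\xi_i\,\frac{e_0'(\Gamma_2^\pm)^{-1}[Y_i-\tilde\mu(X_i)]\,r_2(X_i/h_n)K(X_i/h_n)\delta_i^\pm}{\sqrt{nh_n}\,\hat f_X(0)}.$$ Then the limits in $\tau_{SMRD}=\lim_{x\downarrow0}E[Y|X=x]-\lim_{x\uparrow0}E[Y|X=x]$ exist, and there is $\sigma_{SMRD}>0$ such that (i) $\sqrt{nh_n}\,(\hat\tau_{SMRD}-\tau_{SMRD})$ converges in distribution to $N(0,\sigma^2_{SMRD})$; (ii) whenever $\hat f_X(0)$ is consistent, $\hat\nu^+_{\xi,n}-\hat\nu^-_{\xi,n}$ converges weakly to $N(0,\sigma^2_{SMRD})$ conditionally on the data, in probability: $$\sup_{g}\Big|E_{\xi|x}\,g(\hat\nu^+_{\xi,n}-\hat\nu^-_{\xi,n})-\int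 g\,dN(0,\sigma^2_{SMRD})\Big|\to0\quad\text{in }\mathbb P^x\text{-probability},$$ where the supremum is over all $g:\mathbb R\to\mathbb R$ with Lipschitz constant and supremum norm at most $1$ and $E_{\xi|x}$ is the expectation over the multipliers with the data held fixed. In particular this holds for the kernel density estimator $\hat f_X(0)=\frac1{nb_n}\sum_{i=1}^nK(X_i/b_n)$ if $\int K=1$, $b_n>0$, $b_n\to0$ and $nb_n\to\infty$. -/

import Mathlib

open MeasureTheory ProbabilityTheory Filter Topology
open scoped ENNReal NNReal Matrix

namespace SharpRD

noncomputable section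

/-- The monomial vector `r_p(u) = (1, u, …, u^p)`. -/
def monomials (p : ℕ) (u : ℝ) : Fin (p + 1) → ℝ := fun j => u ^ (j : ℕ)

/-- `Γ_p = ∫_S K(u) r_p(u) r_p(u)' du`; here `S = [0, ∞)` gives `Γ_p^+` and `S = (-∞, 0]` gives
`Γ_p^-`. -/
def kernelMatrix (p : ℕ) (K : ℝ → ℝ) (S : Set ℝ) : Matrix (Fin (p + 1)) (Fin (p + 1)) ℝ :=
  Matrix.of fun i j => ∫ u in S, K u * (monomials p u i * monomials p u j)

/-- `1{x ∈ S}`; for `S = [0, ∞)` and `S = (-∞, 0]` these are the side indicators `δ^+`, `δ^-`. -/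
def side (S : Set ℝ) (x : ℝ) : ℝ := S.indicator (fun _ => (1 : ℝ)) x

/-- `𝓕` is of VC type with respect to the measurable envelope `F`: there are `A ≥ 1`, `V ≥ 1` such
that for every probability measure `Q` and every `0 < ε ≤ 1` the class `𝓕` is covered by at most
`(A / ε) ^ V` closed `L²(Q)`-balls of radius `ε ‖F‖_{Q,2}` with centres in `𝓕`. -/
structure IsVCType (𝓕 : Set (ℝ → ℝ)) (F : ℝ → ℝ) : Prop where
  measurable_envelope : Measurable F
  measurable_mem : ∀ f ∈ 𝓕, Measurable f
  envelope : ∀ f ∈ 𝓕, ∀ x, |f x| ≤ F x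
  covering : ∃ A V : ℝ, 1 ≤ A ∧ 1 ≤ V ∧
    ∀ Q : Measure ℝ, IsProbabilityMeasure Q → ∀ ε : ℝ, 0 < ε → ε ≤ 1 →
      ∃ T : Finset (ℝ → ℝ), (∀ g ∈ T, g ∈ 𝓕) ∧ (T.card : ℝ) ≤ (A / ε) ^ V ∧
        ∀ f ∈ 𝓕, ∃ g ∈ T, eLpNorm (f - g) 2 Q ≤ ENNReal.ofReal ε * eLpNorm F 2 Q

/-- Sampling assumption: `(Yᵢ, Xᵢ)`, `i = 0, 1, …`, are independent copies of `(Y, X)`, and `X` has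
the density `fX`, continuously differentiable on `[a, b]` with `a < 0 < b`, and `fX 0 > 0`. In the
sharp design the treatment is the function `1{X ≥ 0}` of `X`, so it carries no further data. -/
structure AssumptionS {Ω : Type*} [MeasurableSpace Ω] (P : Measure Ω) (Y X : Ω → ℝ)
    (Ys Xs : ℕ → Ω → ℝ) (fX : ℝ → ℝ) (a b : ℝ) : Prop where
  indep : iIndepFun (fun i ω => (Ys i ω, Xs i ω)) P
  copies : ∀ i, IdentDistrib (fun ω => (Ys i ω, Xs i ω)) (fun ω => (Y ω, X ω)) P P
  neg_left : a < 0
  pos_right : 0 < b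
  density_measurable : Measurable fX
  density_nonneg : ∀ x, 0 ≤ fX x
  density : HasLaw X (volume.withDensity fun x => ENNReal.ofReal (fX x)) P
  density_smooth : ContDiffOn ℝ 1 fX (Set.Icc a b)
  density_pos : 0 < fX 0

/-- Kernel assumption, for local polynomials of order `p`. A kernel on `[-1, 1]` is a function on
`ℝ` that vanishes outside `[-1, 1]`; it may jump at `±1`. -/
structure AssumptionK (p : ℕ) (K : ℝ → ℝ) : Prop where
  nonneg : ∀ u, 0 ≤ K u
  support : ∀ u, u ∉ Set.Icc (-1 : ℝ) 1 → K u = 0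
  bounded : ∃ C, ∀ u, K u ≤ C
  continuousOn : ContinuousOn K (Set.Icc (-1) 1)
  vc : ∃ F, IsVCType {f : ℝ → ℝ | ∃ h : ℝ, 0 < h ∧ f = fun x => K (x / h)} F
  posDef_right : (kernelMatrix p K (Set.Ici 0)).PosDef
  posDef_left : (kernelMatrix p K (Set.Iic 0)).PosDef

/-- Multiplier assumption: independent standard normal variables on a probability space of their
own. -/
structure AssumptionM {Ξ : Type*} [MeasurableSpace Ξ] (Q : Measure Ξ) (ξ : ℕ → Ξ → ℝ) : Prop where
  indep : iIndepFun ξ Q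
  normal : ∀ i, HasLaw (ξ i) (gaussianReal 0 1) Q

/-- `E[Y | X = x]`, for a regular conditional distribution `κ` of `Y` given `X`. -/
def condMean (κ : Kernel ℝ ℝ) (x : ℝ) : ℝ := ∫ y, y ∂(κ x)

/-- `V(Y | X = x)`, for a regular conditional distribution `κ` of `Y` given `X`. -/
def condVar (κ : Kernel ℝ ℝ) (x : ℝ) : ℝ := variance id (κ x)

/-- `E[|Y|^q | X = x] ∈ [0, ∞]`, for a regular conditional distribution `κ` of `Y` given `X`. -/
def condAbsMoment (κ : Kernel ℝ ℝ) (q x : ℝ) : ℝ≥0∞ := ∫⁻ y, ENNReal.ofReal (|y| ^ q) ∂(κ x)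

/-- `g` and its derivatives up to order `3` exist and are Lipschitz on `S` (one-sided derivatives at
an endpoint that belongs to `S`). -/
def LipschitzDerivs (g : ℝ → ℝ) (S : Set ℝ) : Prop :=
  ContDiffOn ℝ 3 g S ∧ ∀ j ≤ 3, ∃ C : ℝ≥0, LipschitzOnWith C (iteratedDerivWithin j g S) S

/-- Assumptions on the conditional distribution `κ` of the outcome given the running variable and
on the bandwidths `h n`. The conditional moment of order `2 + ε` is finite at every point of
`[a, b] \ {0}` and bounded in a punctured neighbourhood of the cutoff `0`. -/
structure AssumptionSMRD (κ : Kernel ℝ ℝ) (a b : ℝ) (h : ℕ → ℝ) : Prop where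
  moment : ∃ ε : ℝ, 0 < ε ∧
    (∀ x ∈ Set.Icc a b \ {0}, condAbsMoment κ (2 + ε) x < ∞) ∧
    ∃ M : ℝ≥0, ∀ᶠ x in 𝓝[≠] (0 : ℝ), condAbsMoment κ (2 + ε) x ≤ M
  mean_left : LipschitzDerivs (condMean κ) (Set.Ico a 0)
  mean_right : LipschitzDerivs (condMean κ) (Set.Ioc 0 b)
  bandwidth_pos : ∀ n, 0 < h n
  bandwidth_zero : Tendsto h atTop (𝓝 0)
  bandwidth_seven : Tendsto (fun n : ℕ => (n : ℝ) * h n ^ 7) atTop (𝓝 0)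
  bandwidth_two : Tendsto (fun n : ℕ => (n : ℝ) * h n ^ 2) atTop atTop
  var_smooth : ContDiffOn ℝ 1 (condVar κ) (Set.Icc a b \ {0})
  var_deriv_bounded : ∃ C : ℝ, ∀ x ∈ Set.Icc a b \ {0},
    |derivWithin (condVar κ) (Set.Icc a b \ {0}) x| ≤ C
  var_right : ∃ v : ℝ, 0 < v ∧ Tendsto (condVar κ) (𝓝[>] 0) (𝓝 v)
  var_left : ∃ v : ℝ, 0 < v ∧ Tendsto (condVar κ) (𝓝[<] 0) (𝓝 v)

/-- `τ = lim_{x ↓ 0} E[Y | X = x] - lim_{x ↑ 0} E[Y | X = x]`; both limits exist. -/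
def IsSharpMeanEstimand (κ : Kernel ℝ ℝ) (τ : ℝ) : Prop :=
  ∃ mr ml : ℝ, Tendsto (condMean κ) (𝓝[>] 0) (𝓝 mr) ∧ Tendsto (condMean κ) (𝓝[<] 0) (𝓝 ml) ∧
    τ = mr - ml

/-- The one-sided weighted least squares criterion of the first `n` observations `(yᵢ, xᵢ)`. -/
def localCriterion (p : ℕ) (K : ℝ → ℝ) (S : Set ℝ) (h : ℝ) (n : ℕ) (y x : ℕ → ℝ)
    (α : Fin (p + 1) → ℝ) : ℝ :=
  ∑ i ∈ Finset.range n, side S (x i) * (y i - monomials p (x i / h) ⬝ᵥ α) ^ 2 * K (x i / h)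

/-- `α` is a one-sided local polynomial estimator of order `p`: for every sample size `n`, `α n` is
a random vector that minimizes the one-sided weighted least squares criterion. The minimizer is
unique as soon as the empirical counterpart of `Γ_p` is invertible, and any choice is allowed
otherwise. The coordinate `α n ω 0` estimates the one-sided limit of the conditional mean at `0`. -/
def IsLocalPolyEstimator {Ω : Type*} [MeasurableSpace Ω] (P : Measure Ω) (Ys Xs : ℕ → Ω → ℝ)
    (p : ℕ) (K : ℝ → ℝ) (S : Set ℝ) (h : ℕ → ℝ) (α : ℕ → Ω → Fin (p + 1) → ℝ) : Prop :=
  ∀ n, AEMeasurable (α n) P ∧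
    ∀ ω, IsMinOn (localCriterion p K S (h n) n (fun i => Ys i ω) (fun i => Xs i ω))
      Set.univ (α n ω)

/-- First stage estimate `r_p(x/h)' αr 1{x ≥ 0} + r_p(x/h)' αl 1{x ≤ 0}` of `E[Y | X = x]`. -/
def firstStage {p : ℕ} (αr αl : Fin (p + 1) → ℝ) (h x : ℝ) : ℝ :=
  monomials p (x / h) ⬝ᵥ αr * side (Set.Ici 0) x + monomials p (x / h) ⬝ᵥ αl * side (Set.Iic 0) x

/-- One-sided estimated multiplier statistic
`∑ᵢ ξᵢ e₀' Γ_p⁻¹ [yᵢ - m(xᵢ)] r_p(xᵢ/h) K(xᵢ/h) 1{xᵢ ∈ S} / (√(n h) f₀)`, with `Γ_p` that of the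
side `S`, a first stage estimate `m` of the conditional mean and an estimate `f₀` of the density. -/
def multiplierStat (p : ℕ) (K : ℝ → ℝ) (S : Set ℝ) (h : ℝ) (n : ℕ) (y x ξ : ℕ → ℝ)
    (m : ℝ → ℝ) (f₀ : ℝ) : ℝ :=
  ∑ i ∈ Finset.range n,
    ξ i * (((kernelMatrix p K S)⁻¹ *ᵥ monomials p (x i / h)) 0 * (y i - m (x i)) * K (x i / h)
      * side S (x i)) / (Real.sqrt (n * h) * f₀)

/-- The difference of the right and the left estimated multiplier statistic at sample size `n`, as
a function of the data `ω` and the multipliers `z`. -/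
def multiplierDiff {Ω Ξ : Type*} (p : ℕ) (K : ℝ → ℝ) (h : ℕ → ℝ) (Ys Xs : ℕ → Ω → ℝ)
    (ξ : ℕ → Ξ → ℝ) (αr αl : ℕ → Ω → Fin (p + 1) → ℝ) (f₀ : ℕ → Ω → ℝ)
    (n : ℕ) (ω : Ω) (z : Ξ) : ℝ :=
  multiplierStat p K (Set.Ici 0) (h n) n (fun i => Ys i ω) (fun i => Xs i ω) (fun i => ξ i z)
      (firstStage (αr n ω) (αl n ω) (h n)) (f₀ n ω)
    - multiplierStat p K (Set.Iic 0) (h n) n (fun i => Ys i ω) (fun i => Xs i ω) (fun i => ξ i z)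
      (firstStage (αr n ω) (αl n ω) (h n)) (f₀ n ω)

/-- Functions with Lipschitz constant and supremum norm at most `1`. -/
def BL₁ : Set (ℝ → ℝ) := {g | LipschitzWith 1 g ∧ ∀ x, |g x| ≤ 1}

/-- Conditional weak convergence in probability of `T n : Ω × Ξ → ℝ` to the law `ν`:
`sup_{g ∈ BL₁} |E_{ξ|x} g(T n) - ∫ g dν| → 0` in `P`-probability. On the product probability space
`Ω × Ξ` the conditional expectation `E_{ξ|x}` given the data `ω` is integration over `Ξ`. -/
def CondWeakConvInProb {Ω Ξ : Type*} [MeasurableSpace Ω] [MeasurableSpace Ξ] (P : Measure Ω)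
    (Q : Measure Ξ) (T : ℕ → Ω → Ξ → ℝ) (ν : Measure ℝ) : Prop :=
  TendstoInMeasure P (fun n ω => ⨆ g : BL₁, |∫ z, g.1 (T n ω z) ∂Q - ∫ t, g.1 t ∂ν|) atTop
    (fun _ => 0)

/-- The kernel density estimator at `0`. -/
def kernelDensityAtZero {Ω : Type*} (K : ℝ → ℝ) (bw : ℕ → ℝ) (Xs : ℕ → Ω → ℝ) (n : ℕ) (ω : Ω) : ℝ :=
  1 / (n * bw n) * ∑ i ∈ Finset.range n, K (Xs i ω / bw n)

end

end SharpRD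

/-! The one-sided normal equations are a 3 by 3 linear system. Rescale the Taylor coefficients `c j`
of the conditional mean to `c j * h ^ j` and multiply the estimation error by `√(nh)`. The system
then reads Gram matrix times error = noise score + bias score. The Gram matrix tends to `f(0) Γ` by
a local law of large numbers. The noise score is bounded in probability by a local central limit
theorem. The bias score is of order `√(nh) h ^ 3 = √(nh ^ 7)`, because the Taylor remainder is
cubic. A perturbation argument (`perturbed_linear_system`, applied in `LocalDesign.localPoly`)
therefore makes each intercept asymptotically linear in the noise.

Subtracting the two sides leaves a single local sum of noise with weight `f(0)⁻¹ * contrast K`. It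
is asymptotically normal with variance `σ² = f(0)⁻¹ ∫ contrast² v`, where `v` is the step function
of the one-sided conditional variances (`tendstoInDistribution_jump`). This variance is positive
because the right-hand weight integrates to one (`integral_contrast_sq_pos`).

For fixed data the multiplier statistic is exactly centred Gaussian, so its bounded Lipschitz
distance to the limit is controlled by the difference of standard deviations (`iSup_BL₁_le`). Its
conditional variance is a local average of squared residuals divided by the squared density
estimate. Since the first stage is uniformly consistent on the kernel window, residuals may be
replaced by noise, and the average converges to `σ²` (`tendsto_residual_sq`).

Both limit theorems are proved through characteristic functions of row sums, with moments of order
`1 + δ` and `2 + δ`. The kernel window turns these moments into integrals of order `h`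
(`tendsto_integral_local`). -/

namespace SharpRD

noncomputable section

/-! ### Convergence in probability as convergence along a filter -/

/-- The filter on `ℕ × Ω` of the events whose probability at index `n` tends to one. Convergence in
probability to a constant is convergence along this filter. -/
def probFilter {Ω : Type*} [MeasurableSpace Ω] (P : Measure Ω) : Filter (ℕ × Ω) where
  sets := {A | Tendsto (fun n => P {ω | (n, ω) ∉ A}) atTop (𝓝 0)}
  univ_sets := by simp
  sets_of_superset {A B} hA hAB := by
    refine tendsto_of_tendsto_of_tendsto_of_le_of_le tendsto_const_nhds hA
      (fun _ => zero_le) fun n => ?_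
    exact measure_mono fun ω hω h => hω (hAB h)
  inter_sets {A B} hA hB := by
    have h := Tendsto.add hA hB
    rw [add_zero] at h
    refine tendsto_of_tendsto_of_tendsto_of_le_of_le tendsto_const_nhds h
      (fun _ => zero_le) fun n => ?_
    refine (measure_mono fun ω hω => ?_).trans (measure_union_le _ _)
    by_contra hc
    simp only [Set.mem_union, Set.mem_ofPred_eq, not_or, not_not] at hc
    exact hω hc

section

variable {Ω : Type*} [MeasurableSpace Ω] {P : Measure Ω}

lemma eventually_probFilter_iff {p : ℕ × Ω → Prop} :
    (∀ᶠ x in probFilter P, p x) ↔ Tendsto (fun n => P {ω | ¬ p (n, ω)}) atTop (𝓝 0) :=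
  Iff.rfl

lemma tendsto_fst_probFilter : Tendsto Prod.fst (probFilter P) atTop := by
  intro A hA
  rw [mem_map]
  change Tendsto _ _ _
  refine tendsto_const_nhds.congr' ?_
  filter_upwards [hA] with n hn
  simp [hn]

lemma eventually_probFilter_of_ae {p : ℕ → Ω → Prop} (h : ∀ n, ∀ᵐ ω ∂P, p n ω) :
    ∀ᶠ x in probFilter P, p x.1 x.2 := by
  rw [eventually_probFilter_iff]
  exact tendsto_const_nhds.congr fun n => (h n).symm

lemma tendstoInMeasure_iff_probFilter {f : ℕ → Ω → ℝ} {c : ℝ} :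
    TendstoInMeasure P f atTop (fun _ => c) ↔
      Tendsto (fun x : ℕ × Ω => f x.1 x.2) (probFilter P) (𝓝 c) := by
  rw [tendstoInMeasure_iff_dist, Metric.tendsto_nhds]
  refine forall₂_congr fun ε _ => ?_
  rw [eventually_probFilter_iff]
  simp only [not_lt]

/-- Boundedness in probability: the product with anything negligible is negligible. -/
def Stochbounded {ι : Type*} (l : Filter ι) (f : ι → ℝ) : Prop :=
  ∀ e : ι → ℝ, Tendsto e l (𝓝 0) → Tendsto (fun i => e i * f i) l (𝓝 0)

lemma Stochbounded.of_tight {f : ℕ → Ω → ℝ}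
    (h : ∀ ε : ℝ≥0∞, 0 < ε → ∃ M : ℝ, ∀ᶠ n in atTop, P {ω | M < |f n ω|} ≤ ε) :
    Stochbounded (probFilter P) fun x => f x.1 x.2 := by
  intro e he
  rw [Metric.tendsto_nhds] at he ⊢
  intro δ hδ
  rw [eventually_probFilter_iff, ENNReal.tendsto_nhds_zero]
  intro ε hε
  obtain ⟨M, hM⟩ := h (ε / 2) (ENNReal.half_pos hε.ne')
  -- The bound `M` may be zero or negative; `|M| + 1` is a safe divisor.
  have hM' : 0 < |M| + 1 := by positivity
  have h1 := he (δ / (|M| + 1)) (by positivity)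
  rw [eventually_probFilter_iff, ENNReal.tendsto_nhds_zero] at h1
  filter_upwards [hM, h1 (ε / 2) (ENNReal.half_pos hε.ne')] with n hn1 hn2
  refine (measure_mono fun ω hω => ?_).trans
    ((measure_union_le _ _).trans ((add_le_add hn1 hn2).trans_eq (ENNReal.add_halves ε)))
  by_contra hc
  simp only [Set.mem_union, Set.mem_ofPred_eq, not_or, not_lt, dist_zero_right,
    Real.norm_eq_abs, abs_mul] at hc hω
  have : |e (n, ω)| * |f n ω| < δ := by
    calc |e (n, ω)| * |f n ω| ≤ |e (n, ω)| * (|M| + 1) := by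
          gcongr
          linarith [hc.1, le_abs_self M]
      _ < δ / (|M| + 1) * (|M| + 1) := by gcongr; exact lt_of_not_ge hc.2
      _ = δ := by field_simp
  linarith

end

/-! ### Characteristic functions of sums over i.i.d. triangular arrays -/

/-- For `|x| ≤ 1` the quadratic Taylor bound is stronger, and for `|x| ≥ 1` the triangle inequality
suffices. The intermediate exponent lets the law of large numbers work without second moments. -/
lemma norm_cexp_mul_I_sub_le_rpow {δ : ℝ} (h0 : 0 < δ) (h1 : δ ≤ 1) (x : ℝ) :
    ‖Complex.exp (x * Complex.I) - 1 - x * Complex.I‖ ≤ 4 * |x| ^ (1 + δ) := by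
  have hn : ‖(x * Complex.I : ℂ)‖ = |x| := by simp
  rcases le_total |x| 1 with hx | hx
  · have h := Complex.norm_exp_sub_one_sub_id_le (x := x * Complex.I) (by rw [hn]; exact hx)
    rw [hn] at h
    refine h.trans ?_
    have : |x| ^ (2 : ℝ) ≤ |x| ^ (1 + δ) := by
      rcases (abs_nonneg x).eq_or_lt with h' | h'
      · rw [← h', Real.zero_rpow (by norm_num), Real.zero_rpow (by linarith)]
      · exact Real.rpow_le_rpow_of_exponent_ge h' hx (by linarith)
    rw [Real.rpow_two] at this
    nlinarith [Real.rpow_nonneg (abs_nonneg x) (1 + δ)]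
  · have h2 : |x| ≤ |x| ^ (1 + δ) := by
      simpa using Real.rpow_le_rpow_of_exponent_le hx (by linarith : (1 : ℝ) ≤ 1 + δ)
    calc _ ≤ ‖Complex.exp (x * Complex.I)‖ + ‖(1 : ℂ)‖ + ‖(x * Complex.I : ℂ)‖ :=
          (norm_sub_le _ _).trans (add_le_add_left (norm_sub_le _ _) _)
      _ ≤ 4 * |x| ^ (1 + δ) := by
        rw [Complex.norm_exp_ofReal_mul_I, hn, norm_one]; linarith

lemma norm_cexp_mul_I_sub_quadratic_le_rpow {δ : ℝ} (h0 : 0 < δ) (h1 : δ ≤ 1) (x : ℝ) :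
    ‖Complex.exp (x * Complex.I) - 1 - x * Complex.I + (x ^ 2 / 2 : ℝ)‖ ≤ 4 * |x| ^ (2 + δ) := by
  have hn : ‖(x * Complex.I : ℂ)‖ = |x| := by simp
  rcases le_total |x| 1 with hx | hx
  · have h := Complex.exp_bound (x := x * Complex.I) (by rw [hn]; exact hx) (n := 3) (by norm_num)
    have e : Complex.exp (x * Complex.I) - ∑ m ∈ Finset.range 3, (x * Complex.I) ^ m / m.factorial
        = Complex.exp (x * Complex.I) - 1 - x * Complex.I + (x ^ 2 / 2 : ℝ) := by
      simp [Finset.sum_range_succ, mul_pow, Nat.factorial]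
      ring
    rw [e, hn] at h
    refine h.trans ?_
    have : |x| ^ (3 : ℝ) ≤ |x| ^ (2 + δ) := by
      rcases (abs_nonneg x).eq_or_lt with h' | h'
      · rw [← h', Real.zero_rpow (by norm_num), Real.zero_rpow (by linarith)]
      · exact Real.rpow_le_rpow_of_exponent_ge h' hx (by linarith)
    have e3 : |x| ^ (3 : ℝ) = |x| ^ 3 := by exact_mod_cast Real.rpow_natCast |x| 3
    rw [e3] at this
    norm_num [Nat.factorial]
    nlinarith [Real.rpow_nonneg (abs_nonneg x) (2 + δ), pow_nonneg (abs_nonneg x) 3]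
  · have h2 : |x| ^ 2 ≤ |x| ^ (2 + δ) := by
      rw [← Real.rpow_two]
      exact Real.rpow_le_rpow_of_exponent_le hx (by linarith)
    have h3 : ‖((x ^ 2 / 2 : ℝ) : ℂ)‖ = |x| ^ 2 / 2 := by
      rw [Complex.norm_real, Real.norm_eq_abs, abs_div, abs_pow, abs_two]
    calc _ ≤ ‖Complex.exp (x * Complex.I)‖ + ‖(1 : ℂ)‖ + ‖(x * Complex.I : ℂ)‖
          + ‖((x ^ 2 / 2 : ℝ) : ℂ)‖ :=
          (norm_add_le _ _).trans (add_le_add_left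
            ((norm_sub_le _ _).trans (add_le_add_left (norm_sub_le _ _) _)) _)
      _ ≤ 4 * |x| ^ (2 + δ) := by
        rw [Complex.norm_exp_ofReal_mul_I, hn, norm_one, h3]; nlinarith

/-- `Z 0, Z 1, …` is an i.i.d. sequence with law `ρ`. -/
structure IsSample {Ω β : Type*} [MeasurableSpace Ω] [MeasurableSpace β] (P : Measure Ω)
    (ρ : Measure β) (Z : ℕ → Ω → β) : Prop where
  indep : iIndepFun Z P
  law : ∀ i, HasLaw (Z i) ρ P

section

variable {Ω β : Type*} [MeasurableSpace Ω] [MeasurableSpace β] {P : Measure Ω} {ρ : Measure β}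
  {Z : ℕ → Ω → β}

lemma IsSample.aemeasurable_sum (hZ : IsSample P ρ Z) {H : β → ℝ} (hH : Measurable H) (n : ℕ) :
    AEMeasurable (fun ω => ∑ i ∈ Finset.range n, H (Z i ω)) P :=
  Finset.aemeasurable_fun_sum _ fun i _ => hH.comp_aemeasurable (hZ.law i).aemeasurable

lemma IsSample.charFun_map_sum (hZ : IsSample P ρ Z) {H : β → ℝ} (hH : Measurable H) (n : ℕ)
    (t : ℝ) :
    charFun (P.map fun ω => ∑ i ∈ Finset.range n, H (Z i ω)) t =
      (∫ z, Complex.exp ((t * H z : ℝ) * Complex.I) ∂ρ) ^ n := by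
  have hi : iIndepFun (fun i ω => H (Z i ω)) P := hZ.indep.comp (fun _ => H) (fun _ => hH)
  rw [(hi.restrict _).charFun_map_fun_finsetSum_eq_prod (X := fun i ω => H (Z i ω))
    (fun i _ => hH.comp_aemeasurable (hZ.law i).aemeasurable)]
  rw [Finset.prod_apply, Finset.prod_congr rfl (g := fun _ =>
    ∫ z, Complex.exp ((t * H z : ℝ) * Complex.I) ∂ρ), Finset.prod_const, Finset.card_range]
  intro i _
  have e : P.map (fun ω => H (Z i ω)) = ρ.map H := by
    rw [← (hZ.law i).map_eq, AEMeasurable.map_map_of_aemeasurable hH.aemeasurable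
      (hZ.law i).aemeasurable]
    rfl
  rw [e, charFun_apply_real, integral_map hH.aemeasurable (by fun_prop)]
  simp

/-- The `n`-th power of `1 + z n / n` tends to `exp c` when `z n → c`, so each limit theorem reduces
to one expansion of the characteristic function of a single summand. -/
lemma IsSample.tendsto_charFun (hZ : IsSample P ρ Z) {H : ℕ → β → ℝ} (hH : ∀ n, Measurable (H n))
    (t : ℝ) {c : ℂ} (h : Tendsto (fun n : ℕ =>
      (n : ℂ) * (∫ z, Complex.exp ((t * H n z : ℝ) * Complex.I) ∂ρ - 1)) atTop (𝓝 c)) :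
    Tendsto (fun n : ℕ => charFun (P.map fun ω => ∑ i ∈ Finset.range n, H n (Z i ω)) t) atTop
      (𝓝 (Complex.exp c)) := by
  refine (Complex.tendsto_one_add_pow_exp_of_tendsto h).congr fun n => ?_
  rw [hZ.charFun_map_sum (hH n)]
  ring

variable [IsProbabilityMeasure ρ]

lemma integrable_cexp_mul_I {H : β → ℝ} (hH : Measurable H) (t : ℝ) :
    Integrable (fun z => Complex.exp ((t * H z : ℝ) * Complex.I)) ρ := by
  refine Integrable.of_bound (by fun_prop) 1 (ae_of_all _ fun z => ?_)
  rw [Complex.norm_exp_ofReal_mul_I]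

lemma IsSample.tendsto_charFun_lln (hZ : IsSample P ρ Z) {H : ℕ → β → ℝ}
    (hH : ∀ n, Measurable (H n)) {δ s : ℝ} (hδ : 0 < δ) (hδ1 : δ ≤ 1)
    (hint : ∀ᶠ n in atTop, Integrable (H n) ρ)
    (hint' : ∀ᶠ n in atTop, Integrable (fun z => |H n z| ^ (1 + δ)) ρ)
    (hs : Tendsto (fun n : ℕ => n * ∫ z, H n z ∂ρ) atTop (𝓝 s))
    (h0 : Tendsto (fun n : ℕ => n * ∫ z, |H n z| ^ (1 + δ) ∂ρ) atTop (𝓝 0)) (t : ℝ) :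
    Tendsto (fun n : ℕ => charFun (P.map fun ω => ∑ i ∈ Finset.range n, H n (Z i ω)) t) atTop
      (𝓝 (Complex.exp ((t * s : ℝ) * Complex.I))) := by
  refine hZ.tendsto_charFun hH t ?_
  have hs' : Tendsto (fun n : ℕ => ((t * (n * ∫ z, H n z ∂ρ) : ℝ) : ℂ) * Complex.I) atTop
      (𝓝 ((t * s : ℝ) * Complex.I)) :=
    ((Complex.continuous_ofReal.tendsto _).comp (hs.const_mul t)).mul_const _
  have hr : Tendsto (fun n : ℕ => (n : ℂ) * (∫ z, Complex.exp ((t * H n z : ℝ) * Complex.I) ∂ρ - 1)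
      - ((t * (n * ∫ z, H n z ∂ρ) : ℝ) : ℂ) * Complex.I) atTop (𝓝 0) := by
    refine squeeze_zero_norm' ?_ (by simpa using h0.const_mul (4 * |t| ^ (1 + δ)))
    filter_upwards [hint, hint'] with n hn hn'
    have hI := (integrable_cexp_mul_I (ρ := ρ) (hH n) t)
    have hI1 : Integrable (fun z => Complex.exp ((t * H n z : ℝ) * Complex.I) - 1) ρ :=
      hI.sub (integrable_const _)
    have hJ : Integrable (fun z => ((t * H n z : ℝ) : ℂ) * Complex.I) ρ :=
      ((hn.const_mul t).ofReal).mul_const _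
    have e : (n : ℂ) * (∫ z, Complex.exp ((t * H n z : ℝ) * Complex.I) ∂ρ - 1)
        - ((t * (n * ∫ z, H n z ∂ρ) : ℝ) : ℂ) * Complex.I = n * ∫ z,
          (Complex.exp ((t * H n z : ℝ) * Complex.I) - 1 - ((t * H n z : ℝ) : ℂ) * Complex.I) ∂ρ := by
      rw [integral_sub hI1 hJ, integral_sub hI (integrable_const _),
        integral_mul_const, integral_complex_ofReal, integral_const_mul]
      simp
      ring
    rw [e, norm_mul, Complex.norm_natCast]
    have : ‖∫ z, (Complex.exp ((t * H n z : ℝ) * Complex.I) - 1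
        - ((t * H n z : ℝ) : ℂ) * Complex.I) ∂ρ‖ ≤ ∫ z, 4 * |t| ^ (1 + δ) * |H n z| ^ (1 + δ) ∂ρ := by
      refine norm_integral_le_of_norm_le (hn'.const_mul _) (ae_of_all _ fun z => ?_)
      refine (norm_cexp_mul_I_sub_le_rpow hδ hδ1 _).trans_eq ?_
      rw [abs_mul, Real.mul_rpow (abs_nonneg _) (abs_nonneg _)]
      ring
    rw [integral_const_mul] at this
    calc _ ≤ (n : ℝ) * (4 * |t| ^ (1 + δ) * ∫ z, |H n z| ^ (1 + δ) ∂ρ) := by gcongr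
      _ = _ := by ring
  simpa using hr.add hs'

/-- Lyapunov's argument: the first-order term vanishes, the second-order term gives `v`, and the
remainder is dominated by the moment of order `2 + δ`. -/
lemma IsSample.tendsto_charFun_clt (hZ : IsSample P ρ Z) {H : ℕ → β → ℝ}
    (hH : ∀ n, Measurable (H n)) {δ v : ℝ} (hδ : 0 < δ) (hδ1 : δ ≤ 1)
    (hint : ∀ᶠ n in atTop, Integrable (H n) ρ)
    (hint2 : ∀ᶠ n in atTop, Integrable (fun z => H n z ^ 2) ρ)
    (hint' : ∀ᶠ n in atTop, Integrable (fun z => |H n z| ^ (2 + δ)) ρ)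
    (hmean : ∀ᶠ n in atTop, ∫ z, H n z ∂ρ = 0)
    (hv : Tendsto (fun n : ℕ => n * ∫ z, H n z ^ 2 ∂ρ) atTop (𝓝 v))
    (h0 : Tendsto (fun n : ℕ => n * ∫ z, |H n z| ^ (2 + δ) ∂ρ) atTop (𝓝 0)) (t : ℝ) :
    Tendsto (fun n : ℕ => charFun (P.map fun ω => ∑ i ∈ Finset.range n, H n (Z i ω)) t) atTop
      (𝓝 (Complex.exp ((-(t ^ 2 * v / 2) : ℝ)))) := by
  refine hZ.tendsto_charFun hH t ?_
  have hs' : Tendsto (fun n : ℕ => ((-(t ^ 2 * (n * ∫ z, H n z ^ 2 ∂ρ) / 2) : ℝ) : ℂ)) atTop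
      (𝓝 ((-(t ^ 2 * v / 2) : ℝ))) :=
    ((Complex.continuous_ofReal.tendsto _).comp ((hv.const_mul (t ^ 2)).div_const 2).neg)
  have hr : Tendsto (fun n : ℕ => (n : ℂ) * (∫ z, Complex.exp ((t * H n z : ℝ) * Complex.I) ∂ρ - 1)
      - ((-(t ^ 2 * (n * ∫ z, H n z ^ 2 ∂ρ) / 2) : ℝ) : ℂ)) atTop (𝓝 0) := by
    refine squeeze_zero_norm' ?_ (by simpa using h0.const_mul (4 * |t| ^ (2 + δ)))
    filter_upwards [hint, hint2, hint', hmean] with n hn hn2 hn' hm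
    have hI := (integrable_cexp_mul_I (ρ := ρ) (hH n) t)
    have hI1 : Integrable (fun z => Complex.exp ((t * H n z : ℝ) * Complex.I) - 1) ρ :=
      hI.sub (integrable_const _)
    have hJ : Integrable (fun z => ((t * H n z : ℝ) : ℂ) * Complex.I) ρ :=
      ((hn.const_mul t).ofReal).mul_const _
    have hI2 : Integrable (fun z => Complex.exp ((t * H n z : ℝ) * Complex.I) - 1
        - ((t * H n z : ℝ) : ℂ) * Complex.I) ρ := hI1.sub hJ
    have hJ2 : Integrable (fun z => (((t * H n z) ^ 2 / 2 : ℝ) : ℂ)) ρ := by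
      simp_rw [mul_pow]
      exact ((hn2.const_mul _).div_const 2).ofReal
    have hJ0 : ∫ z, ((t * H n z : ℝ) : ℂ) * Complex.I ∂ρ = 0 := by
      rw [integral_mul_const, integral_complex_ofReal, integral_const_mul, hm]
      simp
    have e : (n : ℂ) * (∫ z, Complex.exp ((t * H n z : ℝ) * Complex.I) ∂ρ - 1)
        - ((-(t ^ 2 * (n * ∫ z, H n z ^ 2 ∂ρ) / 2) : ℝ) : ℂ) = n * ∫ z,
          (Complex.exp ((t * H n z : ℝ) * Complex.I) - 1 - ((t * H n z : ℝ) : ℂ) * Complex.I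
            + ((t * H n z) ^ 2 / 2 : ℝ)) ∂ρ := by
      rw [integral_add hI2 hJ2, integral_sub hI1 hJ, integral_sub hI (integrable_const _), hJ0,
        integral_complex_ofReal, integral_div]
      simp_rw [mul_pow]
      rw [integral_const_mul]
      simp
      ring
    rw [e, norm_mul, Complex.norm_natCast]
    have : ‖∫ z, (Complex.exp ((t * H n z : ℝ) * Complex.I) - 1
        - ((t * H n z : ℝ) : ℂ) * Complex.I + ((t * H n z) ^ 2 / 2 : ℝ)) ∂ρ‖
          ≤ ∫ z, 4 * |t| ^ (2 + δ) * |H n z| ^ (2 + δ) ∂ρ := by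
      refine norm_integral_le_of_norm_le (hn'.const_mul _) (ae_of_all _ fun z => ?_)
      refine (norm_cexp_mul_I_sub_quadratic_le_rpow hδ hδ1 _).trans_eq ?_
      rw [abs_mul, Real.mul_rpow (abs_nonneg _) (abs_nonneg _)]
      ring
    rw [integral_const_mul] at this
    calc _ ≤ (n : ℝ) * (4 * |t| ^ (2 + δ) * ∫ z, |H n z| ^ (2 + δ) ∂ρ) := by gcongr
      _ = _ := by ring
  simpa using hr.add hs'

end

/-! ### Limits in distribution: constant limits and tightness -/

section

variable {Ω : Type*} [MeasurableSpace Ω] {P : Measure Ω} [IsProbabilityMeasure P]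

lemma tendstoInDistribution_of_charFun {Ω' : Type*} [MeasurableSpace Ω'] {P' : Measure Ω'}
    [IsProbabilityMeasure P'] {W : ℕ → Ω → ℝ} (hW : ∀ n, AEMeasurable (W n) P) {V : Ω' → ℝ}
    (hV : AEMeasurable V P')
    (h : ∀ t, Tendsto (fun n => charFun (P.map (W n)) t) atTop (𝓝 (charFun (P'.map V) t))) :
    TendstoInDistribution W atTop V (fun _ => P) P' where
  forall_aemeasurable := hW
  aemeasurable_limit := hV
  tendsto := ProbabilityMeasure.tendsto_iff_tendsto_charFun.2 h

/-- Portmanteau applied to the complement of a ball around `s`: its frontier misses `s`, hence is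
null for the point mass at `s`. -/
lemma TendstoInDistribution.tendsto_probFilter {Ω' : Type*} [MeasurableSpace Ω'] {P' : Measure Ω'}
    [IsProbabilityMeasure P'] {W : ℕ → Ω → ℝ} {s : ℝ}
    (h : TendstoInDistribution W atTop (fun _ : Ω' => s) (fun _ => P) P') :
    Tendsto (fun x : ℕ × Ω => W x.1 x.2) (probFilter P) (𝓝 s) := by
  rw [Metric.tendsto_nhds]
  intro ε hε
  rw [eventually_probFilter_iff]
  have hl := ProbabilityMeasure.tendsto_measure_of_null_frontier_of_tendsto' h.tendsto
    (E := (Metric.ball s ε)ᶜ) (by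
      rw [frontier_compl, ProbabilityMeasure.coe_mk, Measure.map_const, Measure.smul_apply,
        Measure.dirac_apply' _ isClosed_frontier.measurableSet, Set.indicator_of_notMem]
      · simp
      · rw [Metric.isOpen_ball.frontier_eq]
        exact fun hs => hs.2 (Metric.mem_ball_self hε))
  simp only [ProbabilityMeasure.coe_mk] at hl
  rw [Measure.map_const, Measure.smul_apply,
    Measure.dirac_apply' _ Metric.isOpen_ball.measurableSet.compl, Set.indicator_of_notMem
      (by simp [hε]), smul_zero] at hl
  refine hl.congr fun n => ?_
  rw [Measure.map_apply_of_aemeasurable (h.forall_aemeasurable n)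
    Metric.isOpen_ball.measurableSet.compl]
  rfl

/-- Convergence of characteristic functions to a function continuous at zero gives tightness. -/
lemma TendstoInDistribution.stochbounded {Ω' : Type*} [MeasurableSpace Ω'] {P' : Measure Ω'}
    [IsProbabilityMeasure P'] {W : ℕ → Ω → ℝ} {V : Ω' → ℝ}
    (h : TendstoInDistribution W atTop V (fun _ => P) P') :
    Stochbounded (probFilter P) fun x => W x.1 x.2 := by
  have hp : ∀ n, IsProbabilityMeasure (P.map (W n)) := fun n =>
    Measure.isProbabilityMeasure_map (h.forall_aemeasurable n)
  have hp' : IsProbabilityMeasure (P'.map V) :=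
    Measure.isProbabilityMeasure_map h.aemeasurable_limit
  have ht : IsTightMeasureSet (Set.range fun n => P.map (W n)) :=
    isTightMeasureSet_of_tendsto_charFun (f := charFun (P'.map V))
      (continuous_charFun.continuousAt)
      (ProbabilityMeasure.tendsto_iff_tendsto_charFun.1 h.tendsto)
  refine Stochbounded.of_tight fun ε hε => ?_
  obtain ⟨M, hM⟩ := ((ENNReal.tendsto_nhds_zero.1
    (tendsto_measure_norm_gt_of_isTightMeasureSet ht) ε hε)).exists
  refine ⟨M, Eventually.of_forall fun n => ?_⟩
  have := (le_iSup₂_of_le (P.map (W n)) ⟨n, rfl⟩ le_rfl).trans hM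
  rw [Measure.map_apply_of_aemeasurable (h.forall_aemeasurable n)
    (measurableSet_lt measurable_const measurable_norm)] at this
  exact this

end

/-! ### Kernel-localised integrals against the joint law -/

/-- Bounded measurable functions supported in `[-1, 1]`. -/
structure IsLocalWeight (ψ : ℝ → ℝ) : Prop where
  measurable : Measurable ψ
  bounded : ∃ B : ℝ, ∀ u, |ψ u| ≤ B
  support : ∀ u, 1 < |u| → ψ u = 0

namespace IsLocalWeight

variable {ψ φ : ℝ → ℝ}

lemma mul_bounded (hψ : IsLocalWeight ψ) (hφ : Measurable φ) {B : ℝ}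
    (hB : ∀ u, |u| ≤ 1 → |φ u| ≤ B) : IsLocalWeight fun u => φ u * ψ u where
  measurable := hφ.mul hψ.measurable
  bounded := by
    obtain ⟨C, hC⟩ := hψ.bounded
    refine ⟨|B| * |C|, fun u => ?_⟩
    rcases le_or_gt |u| 1 with hu | hu
    · rw [abs_mul]
      exact mul_le_mul ((hB u hu).trans (le_abs_self _)) ((hC u).trans (le_abs_self _))
        (abs_nonneg _) (abs_nonneg _)
    · rw [hψ.support u hu, mul_zero, abs_zero]; positivity
  support u hu := by rw [hψ.support u hu, mul_zero]

lemma const_mul (hψ : IsLocalWeight ψ) (c : ℝ) : IsLocalWeight fun u => c * ψ u :=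
  hψ.mul_bounded measurable_const (B := |c|) fun _ _ => le_rfl

lemma add (hψ : IsLocalWeight ψ) (hφ : IsLocalWeight φ) : IsLocalWeight fun u => ψ u + φ u where
  measurable := hψ.measurable.add hφ.measurable
  bounded := by
    obtain ⟨B, hB⟩ := hψ.bounded
    obtain ⟨C, hC⟩ := hφ.bounded
    exact ⟨B + C, fun u => (abs_add_le _ _).trans (add_le_add (hB u) (hC u))⟩
  support u hu := by rw [hψ.support u hu, hφ.support u hu, add_zero]

lemma sub (hψ : IsLocalWeight ψ) (hφ : IsLocalWeight φ) : IsLocalWeight fun u => ψ u - φ u := by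
  simpa [sub_eq_add_neg] using hψ.add (hφ.const_mul (-1))

lemma sq (hψ : IsLocalWeight ψ) : IsLocalWeight fun u => ψ u ^ 2 := by
  obtain ⟨B, hB⟩ := hψ.bounded
  simpa [pow_two] using hψ.mul_bounded hψ.measurable fun u _ => hB u

lemma abs_rpow (hψ : IsLocalWeight ψ) {p : ℝ} (hp : 0 < p) :
    IsLocalWeight fun u => |ψ u| ^ p where
  measurable := (measurable_norm.comp hψ.measurable).pow_const p
  bounded := by
    obtain ⟨B, hB⟩ := hψ.bounded
    refine ⟨B ^ p, fun u => ?_⟩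
    rw [abs_of_nonneg (by positivity)]
    exact Real.rpow_le_rpow (abs_nonneg _) (hB u) hp.le
  support u hu := by rw [hψ.support u hu, abs_zero, Real.zero_rpow hp.ne']

lemma abs (hψ : IsLocalWeight ψ) : IsLocalWeight fun u => |ψ u| := by
  simpa using hψ.abs_rpow one_pos

lemma exists_norm_le (hψ : IsLocalWeight ψ) : ∃ B : ℝ≥0, ∀ u, |ψ u| ≤ B := by
  obtain ⟨B, hB⟩ := hψ.bounded
  exact ⟨B.toNNReal, fun u => (hB u).trans (Real.le_coe_toNNReal B)⟩

lemma abs_le_of_ne_zero (hψ : IsLocalWeight ψ) {h x : ℝ} (hh : 0 < h) (hx : ψ (x / h) ≠ 0) :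
    |x| ≤ h := by
  by_contra hc
  refine hx (hψ.support _ ?_)
  rw [abs_div, abs_of_pos hh, one_lt_div hh]
  exact not_le.1 hc

lemma integrable (hψ : IsLocalWeight ψ) : Integrable ψ := by
  obtain ⟨B, hB⟩ := hψ.bounded
  have : Integrable (Set.indicator (Set.Icc (-1) 1) fun _ : ℝ => B) :=
    (integrable_indicator_iff measurableSet_Icc).2 (by simp)
  refine this.mono' hψ.measurable.aestronglyMeasurable (ae_of_all _ fun u => ?_)
  by_cases hu : u ∈ Set.Icc (-1 : ℝ) 1
  · rw [Set.indicator_of_mem hu]; exact hB u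
  · rw [Set.indicator_of_notMem hu, hψ.support u (lt_of_not_ge fun h => hu (abs_le.1 h)), norm_zero]

end IsLocalWeight

lemma exists_punctured_ball {p : ℝ → Prop} (h : ∀ᶠ x in 𝓝[≠] (0 : ℝ), p x) :
    ∃ r > 0, ∀ x, x ≠ 0 → |x| < r → p x := by
  rw [eventually_nhdsWithin_iff, Metric.eventually_nhds_iff] at h
  obtain ⟨r, hr, h⟩ := h
  exact ⟨r, hr, fun x hx hxr => h (by simpa using hxr) hx⟩

/-- The law of `(X, Y)` when `X` has density `f` and `κ` is the law of `Y` given `X`. -/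
def jointLaw (f : ℝ → ℝ) (κ : Kernel ℝ ℝ) : Measure (ℝ × ℝ) :=
  (volume.withDensity fun x => ENNReal.ofReal (f x)) ⊗ₘ κ

/-- The conditional first absolute moment of `g(X, Y)` given `X = x` is bounded near `x = 0`. -/
def CondBounded (κ : Kernel ℝ ℝ) (g : ℝ × ℝ → ℝ) : Prop :=
  ∃ M : ℝ≥0, ∀ᶠ x in 𝓝[≠] (0 : ℝ), ∫⁻ y, ‖g (x, y)‖ₑ ∂(κ x) ≤ M

/-- The step function with value `r` on `(0, ∞)` and `l` on `(-∞, 0]`. -/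
def twoSided (r l : ℝ) (u : ℝ) : ℝ := if 0 < u then r else l

lemma measurable_twoSided (r l : ℝ) : Measurable (twoSided r l) :=
  Measurable.ite measurableSet_Ioi measurable_const measurable_const

section

variable {f : ℝ → ℝ} {κ : Kernel ℝ ℝ} [IsMarkovKernel κ] {ψ : ℝ → ℝ} {g : ℝ × ℝ → ℝ}

lemma CondBounded.const (c : ℝ) : CondBounded κ fun _ => c :=
  ⟨‖c‖₊, Eventually.of_forall fun x => by simp [enorm_eq_nnnorm]⟩

/-- Domination up to an additive constant is enough, because each `κ x` has mass one. -/
lemma CondBounded.mono {g' : ℝ × ℝ → ℝ} (hg : CondBounded κ g) (c : ℝ≥0)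
    (h : ∀ᶠ x in 𝓝[≠] (0 : ℝ), ∀ y, |g' (x, y)| ≤ c * (1 + |g (x, y)|)) : CondBounded κ g' := by
  obtain ⟨M, hM⟩ := hg
  refine ⟨c * (1 + M), ?_⟩
  filter_upwards [hM, h] with x hx hxy
  calc ∫⁻ y, ‖g' (x, y)‖ₑ ∂(κ x) ≤ ∫⁻ y, (c : ℝ≥0∞) * (1 + ‖g (x, y)‖ₑ) ∂(κ x) := by
        refine lintegral_mono fun y => ?_
        rw [Real.enorm_eq_ofReal_abs, Real.enorm_eq_ofReal_abs]
        refine (ENNReal.ofReal_le_ofReal (hxy _)).trans_eq ?_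
        rw [ENNReal.ofReal_mul c.coe_nonneg, ENNReal.ofReal_add zero_le_one (abs_nonneg _)]
        simp
    _ = c * (1 + ∫⁻ y, ‖g (x, y)‖ₑ ∂(κ x)) := by
        rw [lintegral_const_mul' _ _ ENNReal.coe_ne_top, lintegral_add_left measurable_const]
        simp
    _ ≤ _ := by push_cast; gcongr

lemma CondBounded.of_rpow {p q : ℝ} (hp : 0 ≤ p) (hpq : p ≤ q)
    (h : CondBounded κ fun z => |g z| ^ q) : CondBounded κ fun z => |g z| ^ p := by
  refine h.mono 1 (Eventually.of_forall fun x y => ?_)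
  set z := (x, y)
  rw [abs_of_nonneg (Real.rpow_nonneg (abs_nonneg (g z)) p),
    abs_of_nonneg (Real.rpow_nonneg (abs_nonneg (g z)) q), NNReal.coe_one, one_mul]
  rcases le_total |g z| 1 with h1 | h1
  · exact (Real.rpow_le_one (abs_nonneg _) h1 hp).trans
      (by linarith [Real.rpow_nonneg (abs_nonneg (g z)) q])
  · exact (Real.rpow_le_rpow_of_exponent_le h1 hpq).trans (by linarith)

lemma CondBounded.of_abs_rpow {q : ℝ} (hq : 1 ≤ q) (h : CondBounded κ fun z => |g z| ^ q) :
    CondBounded κ g := by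
  refine (h.of_rpow zero_le_one hq).mono 1 (Eventually.of_forall fun x y => ?_)
  simp

lemma lintegral_jointLaw (hf : Measurable f) {G : ℝ × ℝ → ℝ≥0∞} (hG : Measurable G) :
    ∫⁻ z, G z ∂(jointLaw f κ) = ∫⁻ x, ENNReal.ofReal (f x) * ∫⁻ y, G (x, y) ∂(κ x) := by
  rw [jointLaw, Measure.lintegral_compProd hG,
    lintegral_withDensity_eq_lintegral_mul _ hf.ennreal_ofReal hG.lintegral_kernel_prod_right']
  rfl

lemma integral_jointLaw (hf : Measurable f) (hf0 : ∀ x, 0 ≤ f x) {G : ℝ × ℝ → ℝ}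
    (hG : Integrable G (jointLaw f κ)) :
    ∫ z, G z ∂(jointLaw f κ) = ∫ x, f x * ∫ y, G (x, y) ∂(κ x) := by
  rw [jointLaw] at hG ⊢
  rw [Measure.integral_compProd hG, integral_withDensity_eq_integral_toReal_smul
    hf.ennreal_ofReal (ae_of_all _ fun _ => ENNReal.ofReal_lt_top)]
  simp_rw [ENNReal.toReal_ofReal (hf0 _), smul_eq_mul]

/-- The window `[-h, h]` has length `2h`, and on it the density, the weight and the conditional
moment are bounded. The point `0`, where the conditional moment is not controlled, is Lebesgue null.
-/
lemma exists_lintegral_local_le (hf : Measurable f) (hfc : ContinuousAt f 0)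
    (hψ : IsLocalWeight ψ) (hg : Measurable g) (hb : CondBounded κ g) :
    ∃ C : ℝ≥0, ∀ᶠ h in 𝓝[>] (0 : ℝ),
      ∫⁻ z, ‖ψ (z.1 / h) * g z‖ₑ ∂(jointLaw f κ) ≤ C * ENNReal.ofReal h := by
  obtain ⟨M, hM⟩ := hb
  obtain ⟨B, hB⟩ := hψ.exists_norm_le
  have hF : ∀ᶠ x in 𝓝[≠] (0 : ℝ), f x < f 0 + 1 :=
    nhdsWithin_le_nhds (hfc.eventually (gt_mem_nhds (by linarith)))
  obtain ⟨r, hr, hrM⟩ := exists_punctured_ball (hM.and hF)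
  refine ⟨(f 0 + 1).toNNReal * (B * M) * 2, ?_⟩
  filter_upwards [Ioo_mem_nhdsGT hr] with h hh
  have hm : Measurable fun z : ℝ × ℝ => ‖ψ (z.1 / h) * g z‖ₑ :=
    ((hψ.measurable.comp (measurable_fst.div_const h)).mul hg).enorm
  rw [lintegral_jointLaw hf hm]
  calc ∫⁻ x, ENNReal.ofReal (f x) * ∫⁻ y, ‖ψ (x / h) * g (x, y)‖ₑ ∂(κ x)
      ≤ ∫⁻ x, (Set.Icc (-h) h).indicator
          (fun _ => ((f 0 + 1).toNNReal * (B * M) : ℝ≥0∞)) x := by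
        refine lintegral_mono_ae ?_
        filter_upwards [Measure.ae_ne volume 0] with x hx0
        simp_rw [enorm_mul]
        rw [lintegral_const_mul _ (by fun_prop)]
        by_cases hx : ψ (x / h) = 0
        · simp [hx]
        · have hxh := hψ.abs_le_of_ne_zero hh.1 hx
          rw [Set.indicator_of_mem (by exact abs_le.1 hxh)]
          obtain ⟨h1, h2⟩ := hrM x hx0 (hxh.trans_lt hh.2)
          gcongr
          · exact ENNReal.ofReal_le_ofReal h2.le
          · rw [Real.enorm_eq_ofReal_abs]
            exact (ENNReal.ofReal_le_ofReal (hB _)).trans_eq (by simp)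
    _ = _ := by
        rw [lintegral_indicator measurableSet_Icc, setLIntegral_const, Real.volume_Icc]
        rw [show h - -h = 2 * h by ring, ENNReal.ofReal_mul zero_le_two]
        push_cast
        rw [ENNReal.ofReal_ofNat]
        ring

lemma exists_integral_local_le (hf : Measurable f) (hfc : ContinuousAt f 0)
    (hψ : IsLocalWeight ψ) (hg : Measurable g) (hb : CondBounded κ g) :
    ∃ C : ℝ, 0 ≤ C ∧ ∀ᶠ h in 𝓝[>] (0 : ℝ),
      Integrable (fun z => ψ (z.1 / h) * g z) (jointLaw f κ) ∧
      ∫ z, |ψ (z.1 / h) * g z| ∂(jointLaw f κ) ≤ C * h := by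
  obtain ⟨C, hC⟩ := exists_lintegral_local_le hf hfc hψ hg hb
  refine ⟨C, C.2, ?_⟩
  filter_upwards [hC, self_mem_nhdsWithin] with h hh h0
  have hm : Measurable fun z : ℝ × ℝ => ψ (z.1 / h) * g z :=
    (hψ.measurable.comp (measurable_fst.div_const h)).mul hg
  refine ⟨⟨hm.aestronglyMeasurable, hh.trans_lt
    (ENNReal.mul_lt_top ENNReal.coe_lt_top ENNReal.ofReal_lt_top)⟩, ?_⟩
  have := integral_norm_eq_lintegral_enorm hm.aestronglyMeasurable (μ := jointLaw f κ)
  simp only [Real.norm_eq_abs] at this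
  rw [this]
  refine (ENNReal.toReal_mono
    (ENNReal.mul_lt_top ENNReal.coe_lt_top ENNReal.ofReal_lt_top).ne hh).trans_eq ?_
  rw [ENNReal.toReal_mul, ENNReal.coe_toReal, ENNReal.toReal_ofReal (le_of_lt h0)]

lemma eventually_integral_local_eq (hf : Measurable f) (hf0 : ∀ x, 0 ≤ f x)
    (hfc : ContinuousAt f 0) (hψ : IsLocalWeight ψ) (hg : Measurable g) (hb : CondBounded κ g) :
    ∀ᶠ h in 𝓝[>] (0 : ℝ), ∫ z, ψ (z.1 / h) * g z ∂(jointLaw f κ) =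
      ∫ x, f x * (ψ (x / h) * ∫ y, g (x, y) ∂(κ x)) := by
  obtain ⟨C, -, hC⟩ := exists_integral_local_le hf hfc hψ hg hb
  filter_upwards [hC] with h hh
  rw [integral_jointLaw hf hf0 hh.1]
  simp_rw [integral_const_mul]

/-- Substitute `x = h u` and use dominated convergence. As `h ↓ 0` the point `h u` approaches `0`
from the side of `u`, so a jump at the cutoff survives as the step function `twoSided r l`. -/
lemma tendsto_integral_local (hf : Measurable f) (hf0 : ∀ x, 0 ≤ f x)
    (hfc : ContinuousAt f 0) (hψ : IsLocalWeight ψ) (hg : Measurable g) (hb : CondBounded κ g)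
    {r l : ℝ} (hr : Tendsto (fun x => ∫ y, g (x, y) ∂(κ x)) (𝓝[>] 0) (𝓝 r))
    (hl : Tendsto (fun x => ∫ y, g (x, y) ∂(κ x)) (𝓝[<] 0) (𝓝 l)) :
    Tendsto (fun h => h⁻¹ * ∫ z, ψ (z.1 / h) * g z ∂(jointLaw f κ)) (𝓝[>] 0)
      (𝓝 (f 0 * ∫ u, ψ u * twoSided r l u)) := by
  set q : ℝ → ℝ := fun x => ∫ y, g (x, y) ∂(κ x) with hq
  have hqm : Measurable q := hg.stronglyMeasurable.integral_kernel_prod_right'.measurable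
  have hlim : Tendsto (fun h => ∫ u, f (h * u) * (ψ u * q (h * u))) (𝓝[>] 0)
      (𝓝 (∫ u, f 0 * (ψ u * twoSided r l u))) := by
    obtain ⟨M, hM⟩ := hb
    obtain ⟨B, hB⟩ := hψ.exists_norm_le
    have hF : ∀ᶠ x in 𝓝[≠] (0 : ℝ), f x < f 0 + 1 :=
      nhdsWithin_le_nhds (hfc.eventually (gt_mem_nhds (by linarith)))
    obtain ⟨ρ, hρ, hρM⟩ := exists_punctured_ball (hM.and hF)
    refine tendsto_integral_filter_of_dominated_convergence
      (fun u => (f 0 + 1) * (|ψ u| * M)) (Eventually.of_forall fun h => ?_) ?_ ?_ ?_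
    · exact ((hf.comp (measurable_const_mul h)).mul (hψ.measurable.mul
        (hqm.comp (measurable_const_mul h)))).aestronglyMeasurable
    · filter_upwards [Ioo_mem_nhdsGT hρ] with h hh
      filter_upwards [Measure.ae_ne volume 0] with u hu
      have hf1 : 0 ≤ f 0 + 1 := by linarith [hf0 0]
      rcases le_or_gt |u| 1 with hu1 | hu1
      · have hlt : |h * u| < ρ := by
          rw [abs_mul, abs_of_pos hh.1]
          nlinarith [hh.1, hh.2, abs_nonneg u]
        obtain ⟨h1, h2⟩ := hρM _ (mul_ne_zero hh.1.ne' hu) hlt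
        have h3 : |q (h * u)| ≤ M := by
          have := (enorm_integral_le_lintegral_enorm (μ := κ (h * u)) fun y => g (h * u, y)).trans h1
          rw [enorm_eq_nnnorm, ENNReal.coe_le_coe] at this
          exact_mod_cast this
        rw [norm_mul, norm_mul, Real.norm_of_nonneg (hf0 _), Real.norm_eq_abs, Real.norm_eq_abs]
        gcongr
      · rw [hψ.support u hu1]; simp
    · exact (hψ.integrable.abs.mul_const _).const_mul _
    · filter_upwards [Measure.ae_ne volume 0] with u hu
      have h0 : Tendsto (fun h : ℝ => h * u) (𝓝[>] 0) (𝓝 0) := by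
        have : Tendsto (fun h : ℝ => h * u) (𝓝 0) (𝓝 (0 * u)) := tendsto_id.mul_const u
        rw [zero_mul] at this
        exact this.mono_left nhdsWithin_le_nhds
      refine (hfc.tendsto.comp h0).mul (Tendsto.const_mul _ ?_)
      rcases lt_or_gt_of_ne hu with hu | hu
      · rw [twoSided, if_neg (not_lt.2 hu.le)]
        refine hl.comp (tendsto_nhdsWithin_iff.2 ⟨h0, ?_⟩)
        filter_upwards [self_mem_nhdsWithin] with h hh
        exact mul_neg_of_pos_of_neg hh hu
      · rw [twoSided, if_pos hu]
        refine hr.comp (tendsto_nhdsWithin_iff.2 ⟨h0, ?_⟩)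
        filter_upwards [self_mem_nhdsWithin] with h hh
        exact mul_pos hh hu
  rw [integral_const_mul] at hlim
  refine hlim.congr' ?_
  filter_upwards [eventually_integral_local_eq hf hf0 hfc hψ hg hb, self_mem_nhdsWithin] with h hh hp
  have hp : 0 < h := hp
  rw [hh]
  have := Measure.integral_comp_div (fun u => f (h * u) * (ψ u * q (h * u))) h
  rw [abs_of_pos hp, smul_eq_mul] at this
  rw [eq_inv_mul_iff_mul_eq₀ hp.ne', ← this]
  simp_rw [mul_div_cancel₀ _ hp.ne', hq]

end

/-! ### Local law of large numbers and local central limit theorem -/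

section

variable {f : ℝ → ℝ} {κ : Kernel ℝ ℝ} [IsMarkovKernel κ] {ψ : ℝ → ℝ} {g : ℝ × ℝ → ℝ} {h : ℕ → ℝ}

lemma tendsto_nhdsGT_zero (hpos : ∀ n, 0 < h n) (h0 : Tendsto h atTop (𝓝 0)) :
    Tendsto h atTop (𝓝[>] 0) :=
  tendsto_nhdsWithin_iff.2 ⟨h0, Eventually.of_forall hpos⟩

/-- The `p`-th absolute moment of one scaled summand is at most a constant times `h n * a n ^ p`.
This is the negligibility condition of both limit theorems. -/
lemma local_moment_tendsto_zero (hf : Measurable f) (hfc : ContinuousAt f 0)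
    (hψ : IsLocalWeight ψ) (hg : Measurable g) (hpos : ∀ n, 0 < h n)
    (h0 : Tendsto h atTop (𝓝 0)) {p : ℝ} (hp : 0 < p) (hb : CondBounded κ fun z => |g z| ^ p)
    {a : ℕ → ℝ} (ha : ∀ n, 0 ≤ a n) (hap : Tendsto (fun n : ℕ => n * h n * a n ^ p) atTop (𝓝 0)) :
    (∀ᶠ n in atTop,
      Integrable (fun z => |a n * (ψ (z.1 / h n) * g z)| ^ p) (jointLaw f κ)) ∧
    Tendsto (fun n : ℕ => n * ∫ z, |a n * (ψ (z.1 / h n) * g z)| ^ p ∂(jointLaw f κ)) atTop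
      (𝓝 0) := by
  have e : ∀ n (z : ℝ × ℝ), |a n * (ψ (z.1 / h n) * g z)| ^ p =
      a n ^ p * (|ψ (z.1 / h n)| ^ p * |g z| ^ p) := fun n z => by
    rw [abs_mul, abs_mul, abs_of_nonneg (ha n), Real.mul_rpow (ha n) (by positivity),
      Real.mul_rpow (by positivity) (by positivity)]
  obtain ⟨C, hC0, hC⟩ := exists_integral_local_le hf hfc (hψ.abs_rpow hp)
    ((measurable_norm.comp hg).pow_const p) hb
  have hC' := (tendsto_nhdsGT_zero hpos h0).eventually hC
  simp_rw [e]
  refine ⟨hC'.mono fun n hn => hn.1.const_mul _, ?_⟩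
  refine squeeze_zero' (Eventually.of_forall fun n => ?_) ?_ (by simpa using hap.const_mul C)
  · exact mul_nonneg (Nat.cast_nonneg n) (integral_nonneg fun z => by have := ha n; positivity)
  · filter_upwards [hC'] with n hn
    rw [integral_const_mul]
    have h1 : ∫ z, |ψ (z.1 / h n)| ^ p * |g z| ^ p ∂(jointLaw f κ) ≤ C * h n :=
      (integral_mono_of_nonneg (ae_of_all _ fun z => mul_nonneg
        (Real.rpow_nonneg (abs_nonneg _) _) (Real.rpow_nonneg (abs_nonneg _) _)) hn.1.abs
        (ae_of_all _ fun z => le_abs_self _)).trans hn.2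
    calc _ ≤ (n : ℝ) * (a n ^ p * (C * h n)) := by
          have := ha n
          gcongr
      _ = _ := by ring

variable {Ω : Type*} [MeasurableSpace Ω] {P : Measure Ω} [IsProbabilityMeasure P]
  {Z : ℕ → Ω → ℝ × ℝ}

lemma IsSample.local_lln (hZ : IsSample P (jointLaw f κ) Z) (hf : Measurable f)
    (hf0 : ∀ x, 0 ≤ f x) (hfc : ContinuousAt f 0) (hψ : IsLocalWeight ψ) (hg : Measurable g)
    (hpos : ∀ n, 0 < h n) (h0 : Tendsto h atTop (𝓝 0))
    (hnh : Tendsto (fun n : ℕ => n * h n) atTop atTop) {δ : ℝ} (hδ : 0 < δ) (hδ1 : δ ≤ 1)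
    (hb : CondBounded κ fun z => |g z| ^ (1 + δ))
    {r l : ℝ} (hr : Tendsto (fun x => ∫ y, g (x, y) ∂(κ x)) (𝓝[>] 0) (𝓝 r))
    (hl : Tendsto (fun x => ∫ y, g (x, y) ∂(κ x)) (𝓝[<] 0) (𝓝 l)) :
    Tendsto (fun x : ℕ × Ω => (x.1 * h x.1)⁻¹ *
        ∑ i ∈ Finset.range x.1, ψ ((Z i x.2).1 / h x.1) * g (Z i x.2))
      (probFilter P) (𝓝 (f 0 * ∫ u, ψ u * twoSided r l u)) := by
  have hρ : IsProbabilityMeasure (jointLaw f κ) := by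
    rw [← (hZ.law 0).map_eq]
    exact Measure.isProbabilityMeasure_map (hZ.law 0).aemeasurable
  set H : ℕ → ℝ × ℝ → ℝ := fun n z => ((n : ℝ) * h n)⁻¹ * (ψ (z.1 / h n) * g z) with hH
  have hHm : ∀ n, Measurable (H n) := fun n =>
    ((hψ.measurable.comp (measurable_fst.div_const (h n))).mul hg).const_mul _
  have hb1 : CondBounded κ g := hb.of_abs_rpow (by linarith)
  obtain ⟨C, -, hC⟩ := exists_integral_local_le hf hfc hψ hg hb1
  have hC' := (tendsto_nhdsGT_zero hpos h0).eventually hC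
  -- With scale `1 / (nh)` this quantity is `(nh) ^ (-δ)`.
  have hap : Tendsto (fun n : ℕ => n * h n * (((n : ℝ) * h n)⁻¹) ^ (1 + δ)) atTop (𝓝 0) := by
    refine ((tendsto_rpow_neg_atTop hδ).comp hnh).congr' ?_
    filter_upwards [hnh.eventually_gt_atTop 0] with n hn
    rw [Function.comp_apply, Real.inv_rpow hn.le, Real.rpow_add hn, Real.rpow_one,
      Real.rpow_neg hn.le]
    field_simp
    rw [div_self hn.ne']
  obtain ⟨hi, hm⟩ := local_moment_tendsto_zero (a := fun n : ℕ => ((n : ℝ) * h n)⁻¹) hf hfc hψ hg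
    hpos h0 (by linarith : 0 < 1 + δ) hb
    (fun n => inv_nonneg.2 (mul_nonneg (Nat.cast_nonneg n) (hpos n).le)) hap
  have hs : Tendsto (fun n : ℕ => n * ∫ z, H n z ∂(jointLaw f κ)) atTop
      (𝓝 (f 0 * ∫ u, ψ u * twoSided r l u)) := by
    refine ((tendsto_integral_local hf hf0 hfc hψ hg hb1 hr hl).comp
      (tendsto_nhdsGT_zero hpos h0)).congr' ?_
    filter_upwards [eventually_gt_atTop 0] with n hn
    have hn' : (n : ℝ) ≠ 0 := by positivity
    have := (hpos n).ne'
    rw [Function.comp_apply, hH]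
    simp_rw [integral_const_mul]
    field_simp
  have hd : TendstoInDistribution (fun (n : ℕ) ω => ∑ i ∈ Finset.range n, H n (Z i ω)) atTop
      (fun _ : Ω => f 0 * ∫ u, ψ u * twoSided r l u) (fun _ => P) P := by
    refine tendstoInDistribution_of_charFun (fun n => hZ.aemeasurable_sum (hHm n) n)
      aemeasurable_const fun t => ?_
    rw [Measure.map_const, measure_univ, one_smul, charFun_dirac]
    convert hZ.tendsto_charFun_lln hHm hδ hδ1 (hC'.mono fun n hn => hn.1.const_mul _) hi hs hm t
      using 3
    simp
  refine (TendstoInDistribution.tendsto_probFilter hd).congr fun x => ?_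
  simp only [hH, Finset.mul_sum]

lemma IsSample.local_clt (hZ : IsSample P (jointLaw f κ) Z) (hf : Measurable f)
    (hf0 : ∀ x, 0 ≤ f x) (hfc : ContinuousAt f 0) (hψ : IsLocalWeight ψ) (hg : Measurable g)
    (hpos : ∀ n, 0 < h n) (h0 : Tendsto h atTop (𝓝 0))
    (hnh : Tendsto (fun n : ℕ => n * h n) atTop atTop) {δ : ℝ} (hδ : 0 < δ) (hδ1 : δ ≤ 1)
    (hb : CondBounded κ fun z => |g z| ^ (2 + δ))
    (hmean : ∀ᶠ x in 𝓝[≠] (0 : ℝ), ∫ y, g (x, y) ∂(κ x) = 0)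
    {r l : ℝ} (hr : Tendsto (fun x => ∫ y, g (x, y) ^ 2 ∂(κ x)) (𝓝[>] 0) (𝓝 r))
    (hl : Tendsto (fun x => ∫ y, g (x, y) ^ 2 ∂(κ x)) (𝓝[<] 0) (𝓝 l)) {v : ℝ≥0}
    (hv : f 0 * ∫ u, ψ u ^ 2 * twoSided r l u = v) :
    TendstoInDistribution (fun (n : ℕ) ω => (Real.sqrt (n * h n))⁻¹ *
        ∑ i ∈ Finset.range n, ψ ((Z i ω).1 / h n) * g (Z i ω))
      atTop (id : ℝ → ℝ) (fun _ => P) (gaussianReal 0 v) := by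
  have hρ : IsProbabilityMeasure (jointLaw f κ) := by
    rw [← (hZ.law 0).map_eq]
    exact Measure.isProbabilityMeasure_map (hZ.law 0).aemeasurable
  set H : ℕ → ℝ × ℝ → ℝ := fun n z => (Real.sqrt (n * h n))⁻¹ * (ψ (z.1 / h n) * g z) with hH
  have hHm : ∀ n, Measurable (H n) := fun n =>
    ((hψ.measurable.comp (measurable_fst.div_const (h n))).mul hg).const_mul _
  have hb1 : CondBounded κ g := hb.of_abs_rpow (by linarith)
  have hb2 : CondBounded κ fun z => g z ^ 2 := by
    have := hb.of_rpow zero_le_two (by linarith : (2 : ℝ) ≤ 2 + δ)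
    simpa using this
  have hh := tendsto_nhdsGT_zero hpos h0
  obtain ⟨C, -, hC⟩ := exists_integral_local_le hf hfc hψ hg hb1
  have hC' := hh.eventually hC
  obtain ⟨C2, -, hC2⟩ := exists_integral_local_le hf hfc hψ.sq (hg.pow_const 2) hb2
  have hC2' := hh.eventually hC2
  have hsq : Tendsto (fun n : ℕ => Real.sqrt (n * h n)) atTop atTop :=
    Real.tendsto_sqrt_atTop.comp hnh
  -- With scale `1 / √(nh)` this quantity is `√(nh) ^ (-δ)`.
  have hap : Tendsto (fun n : ℕ => n * h n * ((Real.sqrt (n * h n))⁻¹) ^ (2 + δ)) atTop (𝓝 0) := by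
    refine ((tendsto_rpow_neg_atTop hδ).comp hsq).congr' ?_
    filter_upwards [hsq.eventually_gt_atTop 0] with n hn
    rw [Function.comp_apply, Real.inv_rpow hn.le, Real.rpow_add hn, Real.rpow_two,
      Real.rpow_neg hn.le, Real.sq_sqrt (Real.sqrt_pos.1 hn).le]
    field_simp
    rw [div_self (Real.sqrt_pos.1 hn).ne']
  obtain ⟨hi, hm⟩ := local_moment_tendsto_zero (a := fun n : ℕ => (Real.sqrt (n * h n))⁻¹) hf hfc
    hψ hg hpos h0 (by linarith : 0 < 2 + δ) hb (fun n => by positivity) hap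
  have e2 : ∀ n z, H n z ^ 2 = ((n : ℝ) * h n)⁻¹ * (ψ (z.1 / h n) ^ 2 * g z ^ 2) := fun n z => by
    rw [hH]
    dsimp only
    rw [mul_pow, mul_pow, inv_pow, Real.sq_sqrt (mul_nonneg (Nat.cast_nonneg n) (hpos n).le)]
  have hs : Tendsto (fun n : ℕ => n * ∫ z, H n z ^ 2 ∂(jointLaw f κ)) atTop (𝓝 (v : ℝ)) := by
    rw [← hv]
    refine ((tendsto_integral_local hf hf0 hfc hψ.sq (hg.pow_const 2) hb2 hr hl).comp hh).congr' ?_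
    filter_upwards [eventually_gt_atTop 0] with n hn
    have hn' : (n : ℝ) ≠ 0 := by positivity
    have := (hpos n).ne'
    rw [Function.comp_apply]
    simp_rw [e2, integral_const_mul]
    field_simp
  -- The mean is exactly zero, not just small, once the window lies in the neighbourhood where the
  -- conditional mean of `g` vanishes.
  have hmean' : ∀ᶠ n in atTop, ∫ z, H n z ∂(jointLaw f κ) = 0 := by
    obtain ⟨ε, hε, hεm⟩ := exists_punctured_ball hmean
    filter_upwards [hh.eventually (eventually_integral_local_eq hf hf0 hfc hψ hg hb1),
      hh.eventually (Ioo_mem_nhdsGT hε)] with n hn hnε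
    rw [hH]
    simp_rw [integral_const_mul]
    rw [hn, integral_eq_zero_of_ae, mul_zero]
    filter_upwards [Measure.ae_ne volume 0] with x hx
    by_cases hx1 : ψ (x / h n) = 0
    · simp [hx1]
    · rw [hεm x hx ((hψ.abs_le_of_ne_zero hnε.1 hx1).trans_lt hnε.2)]
      simp
  have hd : TendstoInDistribution (fun (n : ℕ) ω => ∑ i ∈ Finset.range n, H n (Z i ω)) atTop
      (id : ℝ → ℝ) (fun _ => P) (gaussianReal 0 v) := by
    refine tendstoInDistribution_of_charFun (fun n => hZ.aemeasurable_sum (hHm n) n)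
      aemeasurable_id fun t => ?_
    rw [Measure.map_id, charFun_gaussianReal]
    convert hZ.tendsto_charFun_clt hHm hδ hδ1 (hC'.mono fun n hn => hn.1.const_mul _)
      (hC2'.mono fun n hn => ?_) hi hmean' hs hm t using 3
    · push_cast
      ring
    · simp_rw [e2]
      exact hn.1.const_mul _
  refine hd.congr (fun n => ae_of_all _ fun ω => ?_) (ae_of_all _ fun _ => rfl)
  simp only [hH, Finset.mul_sum]

end

/-! ### One-sided Taylor expansion at the cutoff -/

/-- The function need not be regular at `0` itself. Its derivatives are Lipschitz on the half-open
interval and so extend continuously to `0`; Taylor's theorem at `x0 > 0` is applied first, and then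
`x0 ↓ 0`. -/
lemma LipschitzDerivs.exists_taylor_right {g : ℝ → ℝ} {b : ℝ} (hb : 0 < b)
    (hg : LipschitzDerivs g (Set.Ioc 0 b)) :
    ∃ c : Fin 3 → ℝ, ∃ C : ℝ, 0 ≤ C ∧ Tendsto g (𝓝[>] 0) (𝓝 (c 0)) ∧
      ∀ x ∈ Set.Ioc 0 b, |g x - ∑ j, c j * x ^ (j : ℕ)| ≤ C * |x| ^ 3 := by
  obtain ⟨hcd, hL⟩ := hg
  have hext : ∀ j : Fin 4, ∃ G : ℝ → ℝ, ∃ K : ℝ≥0, LipschitzWith K G ∧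
      Set.EqOn (iteratedDerivWithin j g (Set.Ioc 0 b)) G (Set.Ioc 0 b) := fun j => by
    obtain ⟨K, hK⟩ := hL j (by omega)
    obtain ⟨G, hG, hE⟩ := hK.extend_real
    exact ⟨G, K, hG, hE⟩
  choose G K hG hE using hext
  -- Taylor's theorem uses derivatives within `[x0, x]`; on this smaller set of unique
  -- differentiability they agree with those within `(0, b]`.
  have hE' : ∀ (j : Fin 4) {x0 x y : ℝ}, 0 < x0 → x0 < x → x ≤ b → y ∈ Set.Icc x0 x →
      iteratedDerivWithin j g (Set.Icc x0 x) y = G j y := by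
    intro j x0 x y h0 h1 h2 hy
    have hsub : Set.Icc x0 x ⊆ Set.Ioc 0 b := fun z hz => ⟨h0.trans_le hz.1, hz.2.trans h2⟩
    rw [← hE j (hsub hy), iteratedDerivWithin, iteratedDerivWithin,
      iteratedFDerivWithin_subset hsub (uniqueDiffOn_Icc h1) (uniqueDiffOn_Ioc 0 b)
        (hcd.of_le (by have := j.2; exact_mod_cast (by omega : (j : ℕ) ≤ 3))) hy]
  set C : ℝ := |G 3 0| + K 3 * b with hC
  have hC0 : 0 ≤ C := by positivity
  have hG3 : ∀ y ∈ Set.Ioc 0 b, ‖G 3 y‖ ≤ C := fun y hy => by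
    have h1 := (hG 3).dist_le_mul y 0
    rw [dist_zero_right, Real.dist_eq, Real.norm_of_nonneg hy.1.le] at h1
    have h2 : (K 3 : ℝ) * y ≤ K 3 * b := by gcongr; exact hy.2
    have h3 := abs_sub_abs_le_abs_sub (G 3 y) (G 3 0)
    rw [Real.norm_eq_abs, hC]
    linarith
  refine ⟨fun j => G (j.castSucc) 0 / (j : ℕ).factorial, C, hC0, ?_, fun x hx => ?_⟩
  · have h1 : Tendsto (G 0) (𝓝[>] 0) (𝓝 (G 0 0)) :=
      (hG 0).continuous.continuousAt.mono_left nhdsWithin_le_nhds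
    simp only [Fin.coe_ofNat_eq_mod, Nat.zero_mod, Nat.factorial_zero, Nat.cast_one, div_one]
    refine h1.congr' ?_
    filter_upwards [Ioc_mem_nhdsGT hb] with x hx
    rw [← hE 0 hx]
    simp
  · have hlim : Tendsto (fun x0 : ℝ => |g x - ∑ j : Fin 3,
        G j.castSucc x0 / (j : ℕ).factorial * (x - x0) ^ (j : ℕ)|) (𝓝[>] 0)
        (𝓝 |g x - ∑ j : Fin 3, G j.castSucc 0 / (j : ℕ).factorial * x ^ (j : ℕ)|) := by
      have hc : Continuous (fun x0 : ℝ => |g x - ∑ j : Fin 3,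
          G j.castSucc x0 / (j : ℕ).factorial * (x - x0) ^ (j : ℕ)|) := by
        have := fun j => (hG j).continuous
        fun_prop
      have := (hc.tendsto 0).mono_left (nhdsWithin_le_nhds (s := Set.Ioi 0))
      simpa only [sub_zero] using this
    refine le_of_tendsto hlim ?_
    filter_upwards [Ioo_mem_nhdsGT hx.1] with x0 hx0
    have hsub : Set.Icc x0 x ⊆ Set.Ioc 0 b := fun z hz => ⟨hx0.1.trans_le hz.1, hz.2.trans hx.2⟩
    have ht := taylor_mean_remainder_bound (f := g) (n := 2) (C := C) hx0.2.le
      (by norm_num; exact hcd.mono hsub) (Set.right_mem_Icc.2 hx0.2.le) (fun y hy => by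
        rw [show (2 + 1 : ℕ) = ((3 : Fin 4) : ℕ) from rfl, hE' 3 hx0.1 hx0.2 hx.2 hy]
        exact hG3 y (hsub hy))
    rw [taylor_within_apply, Real.norm_eq_abs, Finset.sum_range] at ht
    have e : ∑ j : Fin 3, G j.castSucc x0 / (j : ℕ).factorial * (x - x0) ^ (j : ℕ) =
        ∑ i : Fin (2 + 1), (((i : ℕ).factorial : ℝ)⁻¹ * (x - x0) ^ (i : ℕ)) •
          iteratedDerivWithin (i : ℕ) g (Set.Icc x0 x) x0 := by
      refine Finset.sum_congr rfl fun j _ => ?_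
      have := hE' j.castSucc hx0.1 hx0.2 hx.2 (Set.left_mem_Icc.2 hx0.2.le)
      rw [Fin.val_castSucc] at this
      rw [this, smul_eq_mul]
      ring
    rw [e]
    refine ht.trans ?_
    have h1 : (x - x0) ^ 3 ≤ |x| ^ 3 := by
      rw [abs_of_pos hx.1]
      exact pow_le_pow_left₀ (by linarith [hx0.2]) (by linarith [hx0.1]) 3
    have h2 : 0 ≤ (x - x0) ^ 3 := pow_nonneg (by linarith [hx0.2]) 3
    norm_num [Nat.factorial]
    nlinarith [mul_le_mul_of_nonneg_left h1 hC0, mul_nonneg hC0 h2]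

/-- Reflection reduces the left side of the cutoff to the right side. -/
lemma LipschitzDerivs.comp_neg {g : ℝ → ℝ} {a : ℝ} (hg : LipschitzDerivs g (Set.Ico a 0)) :
    LipschitzDerivs (fun x => g (-x)) (Set.Ioc 0 (-a)) := by
  have hmaps : Set.MapsTo (fun x : ℝ => -x) (Set.Ioc 0 (-a)) (Set.Ico a 0) := fun x hx =>
    ⟨by linarith [hx.2], by linarith [hx.1]⟩
  refine ⟨hg.1.comp contDiff_neg.contDiffOn hmaps, fun j hj => ?_⟩
  obtain ⟨C, hC⟩ := hg.2 j hj
  refine ⟨C, LipschitzOnWith.of_dist_le_mul fun x hx y hy => ?_⟩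
  have hs : -Set.Ioc 0 (-a) = Set.Ico a 0 := by simp
  rw [iteratedDerivWithin_comp_neg, iteratedDerivWithin_comp_neg, hs, dist_eq_norm, ← smul_sub,
    norm_smul, norm_pow, norm_neg, norm_one, one_pow, one_mul, ← dist_eq_norm, dist_comm x y]
  refine (hC.dist_le_mul _ (hmaps hx) _ (hmaps hy)).trans_eq ?_
  rw [dist_neg_neg, dist_comm]

lemma LipschitzDerivs.exists_taylor_left {g : ℝ → ℝ} {a : ℝ} (ha : a < 0)
    (hg : LipschitzDerivs g (Set.Ico a 0)) :
    ∃ c : Fin 3 → ℝ, ∃ C : ℝ, 0 ≤ C ∧ Tendsto g (𝓝[<] 0) (𝓝 (c 0)) ∧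
      ∀ x ∈ Set.Ico a 0, |g x - ∑ j, c j * x ^ (j : ℕ)| ≤ C * |x| ^ 3 := by
  obtain ⟨c, C, hC, hl, hc⟩ := hg.comp_neg.exists_taylor_right (by linarith)
  refine ⟨fun j => c j * (-1) ^ (j : ℕ), C, hC, ?_, fun x hx => ?_⟩
  · have : Tendsto (fun x : ℝ => -x) (𝓝[<] 0) (𝓝[>] 0) := by
      simpa using tendsto_neg_nhdsLT (a := (0 : ℝ))
    simpa [Function.comp_def] using hl.comp this
  · have := hc (-x) ⟨by linarith [hx.2], by linarith [hx.1]⟩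
    rw [neg_neg, abs_neg] at this
    refine le_of_eq_of_le ?_ this
    congr 2
    refine Finset.sum_congr rfl fun j _ => ?_
    rw [neg_pow x]
    ring

/-! ### Normal equations and perturbed linear systems -/

lemma eq_zero_of_forall_quadratic_nonneg {a b : ℝ} (h : ∀ t : ℝ, 0 ≤ t ^ 2 * a - 2 * t * b) :
    b = 0 := by
  by_contra hb
  rcases le_or_gt a 0 with ha | ha
  · have := h b
    have : 0 < b ^ 2 := by positivity
    nlinarith
  · have := h (b / a)
    have e : (b / a) ^ 2 * a - 2 * (b / a) * b = -(b ^ 2 / a) := by field_simp; ring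
    rw [e] at this
    have : 0 < b ^ 2 / a := by positivity
    linarith

/-- Moving `α` by `t` along coordinate `j` changes the criterion by a quadratic in `t` without
constant term. Minimality makes it nonnegative, so its linear coefficient vanishes. No invertibility
of the Gram matrix is needed. -/
lemma normalEquations {p : ℕ} {K : ℝ → ℝ} {S : Set ℝ} {h : ℝ} {n : ℕ} {y x : ℕ → ℝ}
    {α : Fin (p + 1) → ℝ} (hα : IsMinOn (localCriterion p K S h n y x) Set.univ α)
    (j : Fin (p + 1)) :
    ∑ i ∈ Finset.range n, side S (x i) * K (x i / h) * monomials p (x i / h) j *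
      (y i - monomials p (x i / h) ⬝ᵥ α) = 0 := by
  refine eq_zero_of_forall_quadratic_nonneg (a := ∑ i ∈ Finset.range n,
    side S (x i) * K (x i / h) * monomials p (x i / h) j ^ 2) fun t => ?_
  have := hα (Set.mem_univ (α + t • Pi.single j 1))
  simp only [Set.mem_ofPred_eq, localCriterion] at this
  rw [← sub_nonneg, ← Finset.sum_sub_distrib] at this
  refine this.trans_eq ?_
  rw [Finset.mul_sum, Finset.mul_sum, ← Finset.sum_sub_distrib]
  refine Finset.sum_congr rfl fun i _ => ?_
  rw [dotProduct_add, dotProduct_smul, dotProduct_single, smul_eq_mul]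
  ring

lemma abs_mulVec_le {m : ℕ} (M : Matrix (Fin m) (Fin m) ℝ) (d : Fin m → ℝ) :
    ‖M *ᵥ d‖ ≤ (∑ j, ∑ k, |M j k|) * ‖d‖ := by
  refine (pi_norm_le_iff_of_nonneg (by positivity)).2 fun j => ?_
  calc ‖(M *ᵥ d) j‖ ≤ ∑ k, |M j k| * |d k| := by
        rw [Matrix.mulVec, dotProduct, Real.norm_eq_abs]
        refine (Finset.abs_sum_le_sum_abs _ _).trans_eq ?_
        simp_rw [abs_mul]
    _ ≤ ∑ k, |M j k| * ‖d‖ := by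
        gcongr with k
        exact norm_le_pi_norm d k
    _ = (∑ k, |M j k|) * ‖d‖ := by rw [Finset.sum_mul]
    _ ≤ _ := by
        exact mul_le_mul_of_nonneg_right (Finset.single_le_sum (f := fun j => ∑ k, |M j k|)
          (fun i _ => by positivity) (Finset.mem_univ j)) (norm_nonneg _)

/-- Solutions `d` of the perturbed linear systems `G d = S + B`, with `G → A` invertible, `B → 0`
and `S` bounded, are bounded and asymptotically equal to `A⁻¹ S`. -/
lemma perturbed_linear_system {ι : Type*} {l : Filter ι} {m : ℕ}
    {A : Matrix (Fin m) (Fin m) ℝ} (hA : IsUnit A.det) {G : ι → Matrix (Fin m) (Fin m) ℝ}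
    {d S B : ι → Fin m → ℝ} (hG : ∀ j k, Tendsto (fun i => G i j k) l (𝓝 (A j k)))
    (hB : ∀ j, Tendsto (fun i => B i j) l (𝓝 0)) (hS : ∀ j, Stochbounded l fun i => S i j)
    (heq : ∀ᶠ i in l, G i *ᵥ d i = S i + B i) :
    Stochbounded l (fun i => ‖d i‖) ∧
      ∀ j, Tendsto (fun i => d i j - (A⁻¹ *ᵥ S i) j) l (𝓝 0) := by
  set L : ℝ := ∑ j, ∑ k, |A⁻¹ j k| with hL
  have hL0 : 0 ≤ L := by positivity
  set e : ι → ℝ := fun i => ∑ j, ∑ k, |(G i - A) j k| with he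
  have he0 : ∀ i, 0 ≤ e i := fun i => by positivity
  have het : Tendsto e l (𝓝 0) := by
    have : Tendsto e l (𝓝 (∑ _j : Fin m, ∑ _k : Fin m, (0 : ℝ))) := by
      refine tendsto_finsetSum _ fun j _ => tendsto_finsetSum _ fun k _ => ?_
      have := ((hG j k).sub_const (A j k)).abs
      simpa using this
    simpa using this
  set s : ι → ℝ := fun i => ∑ j, (|S i j| + |B i j|) with hs
  have hSB : ∀ i, ‖S i + B i‖ ≤ s i := fun i => by
    refine (pi_norm_le_iff_of_nonneg (by positivity)).2 fun j => ?_
    exact (abs_add_le _ _).trans (Finset.single_le_sum (f := fun j => |S i j| + |B i j|)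
      (fun i _ => by positivity) (Finset.mem_univ j))
  have hsb : Stochbounded l s := by
    intro η hη
    have : Tendsto (fun i => ∑ j, (|η i * S i j| + |η i * B i j|)) l
        (𝓝 (∑ _j : Fin m, (|(0 : ℝ)| + |(0 : ℝ) * 0|))) :=
      tendsto_finsetSum _ fun j _ => (hS j η hη).abs.add (hη.mul (hB j)).abs
    simp only [mul_zero, abs_zero, add_zero, Finset.sum_const_zero] at this
    rw [tendsto_zero_iff_norm_tendsto_zero]
    refine this.congr fun i => ?_
    rw [norm_mul, Real.norm_of_nonneg (by positivity : 0 ≤ s i), hs, Finset.mul_sum]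
    refine Finset.sum_congr rfl fun j _ => ?_
    rw [abs_mul, abs_mul, Real.norm_eq_abs, mul_add]
  -- Only the limit `A` is inverted; the fluctuation `G - A` is moved to the right-hand side.
  have hid : ∀ᶠ i in l, d i - A⁻¹ *ᵥ S i = A⁻¹ *ᵥ (B i - (G i - A) *ᵥ d i) := by
    filter_upwards [heq] with i hi
    rw [Matrix.sub_mulVec, hi]
    have : B i - (S i + B i - A *ᵥ d i) = A *ᵥ d i - S i := by abel
    rw [this, Matrix.mulVec_sub, Matrix.mulVec_mulVec, Matrix.nonsing_inv_mul _ hA,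
      Matrix.one_mulVec]
  -- As soon as `L * e i < 1/2`, the term in `‖d i‖` on the right is absorbed on the left, which
  -- costs the factor `2`.
  have hbd : ∀ᶠ i in l, ‖d i‖ ≤ 2 * L * s i := by
    have h2 : Tendsto (fun i => L * e i) l (𝓝 0) := by simpa using het.const_mul L
    filter_upwards [heq, h2.eventually (gt_mem_nhds (by norm_num : (0 : ℝ) < 1 / 2))] with i hi hi2
    have e1 : d i = A⁻¹ *ᵥ ((S i + B i) - (G i - A) *ᵥ d i) := by
      rw [← hi, Matrix.sub_mulVec, sub_sub_cancel, Matrix.mulVec_mulVec,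
        Matrix.nonsing_inv_mul _ hA, Matrix.one_mulVec]
    have h3 : ‖d i‖ ≤ L * (s i + e i * ‖d i‖) := by
      conv_lhs => rw [e1]
      refine (abs_mulVec_le _ _).trans ?_
      gcongr
      exact (norm_sub_le _ _).trans (add_le_add (hSB i) (abs_mulVec_le _ _))
    nlinarith [norm_nonneg (d i)]
  have hdb : Stochbounded l fun i => ‖d i‖ := by
    intro η hη
    have h1 := (hsb η hη).norm.const_mul (2 * L)
    rw [norm_zero, mul_zero] at h1
    refine squeeze_zero_norm' ?_ h1
    filter_upwards [hbd] with i hi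
    rw [norm_mul, norm_norm, norm_mul, Real.norm_of_nonneg (by positivity : 0 ≤ s i)]
    calc _ ≤ ‖η i‖ * (2 * L * s i) := by gcongr
      _ = _ := by ring
  refine ⟨hdb, fun j => ?_⟩
  have hB' : Tendsto (fun i => ∑ j, |B i j|) l (𝓝 0) := by
    have : Tendsto (fun i => ∑ j, |B i j|) l (𝓝 (∑ _j : Fin m, |(0 : ℝ)|)) :=
      tendsto_finsetSum _ fun j _ => (hB j).abs
    simpa using this
  have h1 : Tendsto (fun i => L * (∑ j, |B i j| + e i * ‖d i‖)) l (𝓝 0) := by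
    simpa using (hB'.add (hdb e het)).const_mul L
  refine squeeze_zero_norm' ?_ h1
  filter_upwards [hid] with i hi
  have h2 : ‖B i‖ ≤ ∑ j, |B i j| := by
    refine (pi_norm_le_iff_of_nonneg (by positivity)).2 fun j => ?_
    exact Finset.single_le_sum (f := fun j => |B i j|) (fun i _ => by positivity)
      (Finset.mem_univ j)
  rw [← Pi.sub_apply, hi]
  refine (norm_le_pi_norm _ j).trans ((abs_mulVec_le _ _).trans ?_)
  gcongr
  exact (norm_sub_le _ _).trans (add_le_add h2 (abs_mulVec_le _ _))

/-! ### Empirical Gram matrix and score -/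

lemma measurable_side {S : Set ℝ} (hS : MeasurableSet S) : Measurable (side S) :=
  measurable_const.indicator hS

lemma abs_side_le_one (S : Set ℝ) (u : ℝ) : |side S u| ≤ 1 := by
  by_cases hu : u ∈ S <;> simp [side, hu]

lemma AssumptionK.isLocalWeight {p : ℕ} {K : ℝ → ℝ} (hK : AssumptionK p K) : IsLocalWeight K where
  measurable := by
    obtain ⟨F, hF⟩ := hK.vc
    -- The kernel itself is the member `h = 1` of the class.
    exact hF.measurable_mem K ⟨1, one_pos, by simp⟩
  bounded := by
    obtain ⟨C, hC⟩ := hK.bounded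
    exact ⟨C, fun u => by rw [abs_of_nonneg (hK.nonneg u)]; exact hC u⟩
  support u hu := hK.support u fun h => absurd (abs_le.2 h) (not_le.2 hu)

lemma IsLocalWeight.sideMoment {K : ℝ → ℝ} (hK : IsLocalWeight K) {S : Set ℝ}
    (hS : MeasurableSet S) (j : ℕ) : IsLocalWeight fun u => side S u * K u * u ^ j := by
  have h1 := hK.mul_bounded (measurable_side hS) fun u _ => abs_side_le_one S u
  have h2 := h1.mul_bounded (φ := fun u => u ^ j) (measurable_id.pow_const j) (B := 1)
    fun u hu => by rw [abs_pow]; exact pow_le_one₀ (abs_nonneg u) hu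
  simpa only [mul_comm] using h2

lemma side_Ici_div {h : ℝ} (hh : 0 < h) (x : ℝ) : side (Set.Ici 0) (x / h) = side (Set.Ici 0) x := by
  simp only [side, Set.indicator, Set.mem_Ici, le_div_iff₀ hh, zero_mul]

lemma side_Iic_div {h : ℝ} (hh : 0 < h) (x : ℝ) : side (Set.Iic 0) (x / h) = side (Set.Iic 0) x := by
  simp only [side, Set.indicator, Set.mem_Iic, div_le_iff₀ hh, zero_mul]

/-- The one-sided empirical Gram matrix of the rescaled monomials. -/
def empGram (K : ℝ → ℝ) (S : Set ℝ) (h : ℝ) (n : ℕ) (x : ℕ → ℝ) : Matrix (Fin 3) (Fin 3) ℝ :=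
  Matrix.of fun j k => ((n : ℝ) * h)⁻¹ * ∑ i ∈ Finset.range n,
    side S (x i / h) * K (x i / h) * (x i / h) ^ ((j : ℕ) + k)

/-- The one-sided kernel-weighted sums of `e` against the rescaled monomials. -/
def empScore (K : ℝ → ℝ) (S : Set ℝ) (h : ℝ) (n : ℕ) (x e : ℕ → ℝ) : Fin 3 → ℝ :=
  fun j => (Real.sqrt (n * h))⁻¹ * ∑ i ∈ Finset.range n,
    side S (x i / h) * K (x i / h) * (x i / h) ^ (j : ℕ) * e i

/-- This is the normal equations after inserting the decomposition of `y` into error `e`, bias `b`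
and a polynomial in the rescaled variable; the polynomial part is what recentres `α` at `c`. -/
lemma empGram_mulVec_eq {K : ℝ → ℝ} {S : Set ℝ} {h : ℝ} {n : ℕ} {y x e b : ℕ → ℝ}
    {α c : Fin 3 → ℝ} (hα : IsMinOn (localCriterion 2 K S h n y x) Set.univ α)
    (hside : ∀ x, side S (x / h) = side S x) (hnh : 0 < n * h)
    (hy : ∀ i, y i = e i + b i + ∑ k : Fin 3, (x i / h) ^ (k : ℕ) * c k) :
    empGram K S h n x *ᵥ (fun j => Real.sqrt (n * h) * (α j - c j)) =
      empScore K S h n x e + empScore K S h n x b := by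
  ext j
  have hne := normalEquations hα j
  have hs : Real.sqrt (n * h) ≠ 0 := (Real.sqrt_pos.2 hnh).ne'
  have hinv : ((n : ℝ) * h)⁻¹ * Real.sqrt (n * h) = (Real.sqrt (n * h))⁻¹ := by
    nth_rewrite 1 [← Real.mul_self_sqrt hnh.le]
    field_simp
  simp only [Pi.add_apply, empScore, empGram, Matrix.mulVec, dotProduct, Matrix.of_apply]
  rw [← mul_add, ← Finset.sum_add_distrib]
  have e1 : ∑ k : Fin 3, ((n : ℝ) * h)⁻¹ * (∑ i ∈ Finset.range n,
      side S (x i / h) * K (x i / h) * (x i / h) ^ ((j : ℕ) + k)) *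
        (Real.sqrt (n * h) * (α k - c k)) = (Real.sqrt (n * h))⁻¹ * ∑ i ∈ Finset.range n,
      side S (x i / h) * K (x i / h) * (x i / h) ^ (j : ℕ) *
        ∑ k : Fin 3, (x i / h) ^ (k : ℕ) * (α k - c k) := by
    rw [← hinv]
    simp_rw [Finset.mul_sum, Finset.sum_mul]
    rw [Finset.sum_comm]
    refine Finset.sum_congr rfl fun i _ => Finset.sum_congr rfl fun k _ => ?_
    rw [pow_add]
    ring
  rw [e1]
  congr 1
  rw [← sub_eq_zero, ← neg_eq_zero, ← Finset.sum_sub_distrib, ← Finset.sum_neg_distrib, ← hne]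
  refine Finset.sum_congr rfl fun i _ => ?_
  rw [hy i, hside]
  simp only [monomials, dotProduct]
  simp_rw [mul_sub, Finset.sum_sub_distrib]
  ring

/-! ### The regression model near the cutoff and asymptotic linearity -/

/-- The regression error. -/
def noise (κ : Kernel ℝ ℝ) (z : ℝ × ℝ) : ℝ := z.2 - condMean κ z.1

lemma measurable_noise (κ : Kernel ℝ ℝ) : Measurable (noise κ) := by
  have : Measurable (condMean κ) :=
    (stronglyMeasurable_id.integral_kernel (κ := κ) (f := fun y : ℝ => y)).measurable
  exact measurable_snd.sub (this.comp measurable_fst)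

/-- A sample from a regression model near the cutoff `0`, with its bandwidths. -/
structure LocalDesign {Ω : Type*} [MeasurableSpace Ω] (P : Measure Ω) (f : ℝ → ℝ) (κ : Kernel ℝ ℝ)
    (Z : ℕ → Ω → ℝ × ℝ) (h : ℕ → ℝ) (δ vr vl : ℝ) : Prop where
  sample : IsSample P (jointLaw f κ) Z
  density_measurable : Measurable f
  density_nonneg : ∀ x, 0 ≤ f x
  density_continuousAt : ContinuousAt f 0
  density_pos : 0 < f 0
  bandwidth_pos : ∀ n, 0 < h n
  bandwidth_zero : Tendsto h atTop (𝓝 0)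
  bandwidth_large : Tendsto (fun n : ℕ => n * h n) atTop atTop
  delta_pos : 0 < δ
  delta_le_one : δ ≤ 1
  noise_moment : CondBounded κ fun z => |noise κ z| ^ (2 + δ)
  noise_mean : ∀ᶠ x in 𝓝[≠] (0 : ℝ), ∫ y, noise κ (x, y) ∂(κ x) = 0
  var_right : Tendsto (fun x => ∫ y, noise κ (x, y) ^ 2 ∂(κ x)) (𝓝[>] 0) (𝓝 vr)
  var_left : Tendsto (fun x => ∫ y, noise κ (x, y) ^ 2 ∂(κ x)) (𝓝[<] 0) (𝓝 vl)
  var_right_pos : 0 < vr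
  var_left_pos : 0 < vl

namespace LocalDesign

variable {Ω : Type*} [MeasurableSpace Ω] {P : Measure Ω} {f : ℝ → ℝ} {κ : Kernel ℝ ℝ}
    {Z : ℕ → Ω → ℝ × ℝ} {h : ℕ → ℝ} {δ vr vl : ℝ}

lemma twoSided_pos (D : LocalDesign P f κ Z h δ vr vl) (u : ℝ) : 0 < twoSided vr vl u := by
  rw [twoSided]
  split_ifs
  exacts [D.var_right_pos, D.var_left_pos]

variable [IsMarkovKernel κ]

/-- The one-sided assumptions say nothing about the conditional law at the cutoff; since the running
variable has a density, no observation falls there almost surely. -/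
lemma ae_ne_zero (D : LocalDesign P f κ Z h δ vr vl) : ∀ᵐ ω ∂P, ∀ i, (Z i ω).1 ≠ 0 := by
  refine ae_all_iff.2 fun i => ?_
  have h1 : ∀ᵐ z ∂(jointLaw f κ), z.1 ≠ 0 := by
    rw [ae_iff]
    simp only [not_not]
    have hm : MeasurableSet {z : ℝ × ℝ | z.1 = 0} := measurable_fst (measurableSet_singleton 0)
    rw [← lintegral_indicator_one hm,
      lintegral_jointLaw D.density_measurable (measurable_one.indicator hm)]
    refine (lintegral_congr_ae (g := 0) ?_).trans (by simp)
    filter_upwards [Measure.ae_ne volume 0] with x hx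
    simp [hx]
  rw [← (D.sample.law i).map_eq] at h1
  exact ae_of_ae_map (D.sample.law i).aemeasurable h1

variable [IsProbabilityMeasure P]

lemma tendsto_weight (D : LocalDesign P f κ Z h δ vr vl) {ψ : ℝ → ℝ} (hψ : IsLocalWeight ψ) :
    Tendsto (fun x : ℕ × Ω => (x.1 * h x.1)⁻¹ *
        ∑ i ∈ Finset.range x.1, ψ ((Z i x.2).1 / h x.1))
      (probFilter P) (𝓝 (f 0 * ∫ u, ψ u)) := by
  have := D.sample.local_lln D.density_measurable D.density_nonneg D.density_continuousAt hψ
    (g := fun _ => 1) measurable_const D.bandwidth_pos D.bandwidth_zero D.bandwidth_large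
    one_pos le_rfl (CondBounded.const _) (r := 1) (l := 1) (by simp) (by simp)
  simpa [twoSided] using this

lemma tendsto_weight_noise_sq (D : LocalDesign P f κ Z h δ vr vl) {ψ : ℝ → ℝ}
    (hψ : IsLocalWeight ψ) :
    Tendsto (fun x : ℕ × Ω => (x.1 * h x.1)⁻¹ *
        ∑ i ∈ Finset.range x.1, ψ ((Z i x.2).1 / h x.1) * noise κ (Z i x.2) ^ 2)
      (probFilter P) (𝓝 (f 0 * ∫ u, ψ u * twoSided vr vl u)) := by
  refine D.sample.local_lln D.density_measurable D.density_nonneg D.density_continuousAt hψ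
    (g := fun z => noise κ z ^ 2) ((measurable_noise κ).pow_const 2) D.bandwidth_pos
    D.bandwidth_zero D.bandwidth_large (half_pos D.delta_pos) (by linarith [D.delta_le_one]) ?_
    D.var_right D.var_left
  -- The law of large numbers for squared noise is used with exponent `1 + δ / 2`, which is exactly
  -- the available moment of order `2 + δ`.
  have e : ∀ z, |noise κ z ^ 2| ^ (1 + δ / 2) = |noise κ z| ^ (2 + δ) := fun z => by
    rw [abs_pow, ← Real.rpow_natCast, ← Real.rpow_mul (abs_nonneg _)]
    congr 1
    push_cast
    ring
  simp_rw [e]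
  exact D.noise_moment

lemma clt (D : LocalDesign P f κ Z h δ vr vl) {ψ : ℝ → ℝ} (hψ : IsLocalWeight ψ) {v : ℝ≥0}
    (hv : f 0 * ∫ u, ψ u ^ 2 * twoSided vr vl u = v) :
    TendstoInDistribution (fun (n : ℕ) ω => (Real.sqrt (n * h n))⁻¹ *
        ∑ i ∈ Finset.range n, ψ ((Z i ω).1 / h n) * noise κ (Z i ω))
      atTop (id : ℝ → ℝ) (fun _ => P) (gaussianReal 0 v) :=
  D.sample.local_clt D.density_measurable D.density_nonneg D.density_continuousAt hψ
    (measurable_noise κ) D.bandwidth_pos D.bandwidth_zero D.bandwidth_large D.delta_pos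
    D.delta_le_one D.noise_moment D.noise_mean D.var_right D.var_left hv

lemma stochbounded_score (D : LocalDesign P f κ Z h δ vr vl) {K : ℝ → ℝ} (hK : IsLocalWeight K)
    {S : Set ℝ} (hS : MeasurableSet S) (j : Fin 3) :
    Stochbounded (probFilter P) fun x => empScore K S (h x.1) x.1 (fun i => (Z i x.2).1)
      (fun i => noise κ (Z i x.2)) j := by
  have hv : 0 ≤ f 0 * ∫ u, (side S u * K u * u ^ (j : ℕ)) ^ 2 * twoSided vr vl u :=
    mul_nonneg D.density_pos.le (integral_nonneg fun u =>
      mul_nonneg (sq_nonneg _) (D.twoSided_pos u).le)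
  have key := TendstoInDistribution.stochbounded
    (D.clt (hK.sideMoment hS j) (Real.coe_toNNReal _ hv).symm)
  simpa only [empScore] using key

lemma tendsto_empGram (D : LocalDesign P f κ Z h δ vr vl) {K : ℝ → ℝ} (hK : IsLocalWeight K)
    {S : Set ℝ} (hS : MeasurableSet S) (j k : Fin 3) :
    Tendsto (fun x : ℕ × Ω => empGram K S (h x.1) x.1 (fun i => (Z i x.2).1) j k)
      (probFilter P) (𝓝 ((f 0 • kernelMatrix 2 K S) j k)) := by
  have e : (f 0 • kernelMatrix 2 K S) j k = f 0 * ∫ u, side S u * K u * u ^ ((j : ℕ) + k) := by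
    rw [Matrix.smul_apply, smul_eq_mul, kernelMatrix, Matrix.of_apply, ← integral_indicator hS]
    congr 2
    ext u
    by_cases hu : u ∈ S <;> simp [side, hu, monomials, pow_add]
  rw [e]
  simpa only [empGram, Matrix.of_apply] using D.tendsto_weight (hK.sideMoment hS ((j : ℕ) + k))

/-- Asymptotic linearity of the one-sided local quadratic estimator. -/
lemma localPoly (D : LocalDesign P f κ Z h δ vr vl)
    (h7 : Tendsto (fun n : ℕ => (n : ℝ) * h n ^ 7) atTop (𝓝 0))
    {K : ℝ → ℝ} (hK : IsLocalWeight K) {S : Set ℝ} (hS : MeasurableSet S)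
    (hside : ∀ r x, 0 < r → side S (x / r) = side S x) (hΓ : (kernelMatrix 2 K S).PosDef)
    {c : Fin 3 → ℝ} {C r : ℝ} (hC : 0 ≤ C) (hr : 0 < r)
    (htaylor : ∀ x ∈ S, x ≠ 0 → |x| < r →
      |condMean κ x - ∑ j, c j * x ^ (j : ℕ)| ≤ C * |x| ^ 3)
    {α : ℕ → Ω → Fin 3 → ℝ} (hα : ∀ n ω, IsMinOn (localCriterion 2 K S (h n) n
      (fun i => (Z i ω).2) (fun i => (Z i ω).1)) Set.univ (α n ω)) :
    (∀ j, Tendsto (fun x : ℕ × Ω => α x.1 x.2 j - c j * h x.1 ^ (j : ℕ)) (probFilter P) (𝓝 0)) ∧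
    Tendsto (fun x : ℕ × Ω => Real.sqrt (x.1 * h x.1) * (α x.1 x.2 0 - c 0) -
      ((f 0 • kernelMatrix 2 K S)⁻¹ *ᵥ empScore K S (h x.1) x.1 (fun i => (Z i x.2).1)
        (fun i => noise κ (Z i x.2))) 0) (probFilter P) (𝓝 0) := by
  set bias : ℕ × Ω → ℕ → ℝ := fun x i =>
    condMean κ (Z i x.2).1 - ∑ j : Fin 3, c j * (Z i x.2).1 ^ (j : ℕ) with hbias
  have hfst : Tendsto Prod.fst (probFilter P) atTop := tendsto_fst_probFilter
  have hdet : IsUnit (f 0 • kernelMatrix 2 K S).det := by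
    rw [Matrix.det_smul]
    exact (mul_pos (pow_pos D.density_pos _) hΓ.det_pos).ne'.isUnit
  -- Undersmoothing: this is the square root of `n * h n ^ 7`.
  have hrate : Tendsto (fun n : ℕ => Real.sqrt (n * h n) * h n ^ 3) atTop (𝓝 0) := by
    have h1 := (Real.continuous_sqrt.tendsto 0).comp h7
    rw [Real.sqrt_zero] at h1
    refine h1.congr fun n => ?_
    have hh := (D.bandwidth_pos n).le
    rw [Function.comp_apply, show (n : ℝ) * h n ^ 7 = (n * h n) * (h n ^ 3) ^ 2 by ring,
      Real.sqrt_mul (by positivity), Real.sqrt_sq (by positivity)]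
  -- On the kernel window the bias is at most `C * h ^ 3`, so the bias score is at most `√(nh) h ^
  -- 3` times a convergent local average.
  have hB : ∀ j, Tendsto (fun x : ℕ × Ω =>
      empScore K S (h x.1) x.1 (fun i => (Z i x.2).1) (bias x) j) (probFilter P) (𝓝 0) := by
    intro j
    have hw := hK.sideMoment hS (j : ℕ)
    have h1 := ((hrate.comp hfst).mul (D.tendsto_weight hw.abs)).const_mul C
    rw [zero_mul, mul_zero] at h1
    refine squeeze_zero_norm' ?_ h1
    filter_upwards [hfst.eventually (D.bandwidth_zero.eventually (gt_mem_nhds hr)),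
      eventually_probFilter_of_ae (p := fun _ ω => ∀ i, (Z i ω).1 ≠ 0) fun _ => D.ae_ne_zero,
      hfst.eventually (D.bandwidth_large.eventually_gt_atTop 0)] with x hx1 hx2 hx3
    have hh := D.bandwidth_pos x.1
    have hs := Real.sqrt_pos.2 hx3
    have hinv : (Real.sqrt (x.1 * h x.1))⁻¹ = Real.sqrt (x.1 * h x.1) * (x.1 * h x.1)⁻¹ := by
      nth_rewrite 3 [← Real.mul_self_sqrt hx3.le]
      field_simp
    rw [empScore, norm_mul, Real.norm_of_nonneg (inv_nonneg.2 hs.le)]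
    calc _ ≤ (Real.sqrt (x.1 * h x.1))⁻¹ * ∑ i ∈ Finset.range x.1,
          |side S ((Z i x.2).1 / h x.1) * K ((Z i x.2).1 / h x.1) *
            ((Z i x.2).1 / h x.1) ^ (j : ℕ)| * (C * h x.1 ^ 3) := by
          refine mul_le_mul_of_nonneg_left ?_ (inv_nonneg.2 hs.le)
          refine (norm_sum_le _ _).trans (Finset.sum_le_sum fun i _ => ?_)
          rw [norm_mul, Real.norm_eq_abs, Real.norm_eq_abs]
          by_cases hz : side S ((Z i x.2).1 / h x.1) * K ((Z i x.2).1 / h x.1) *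
            ((Z i x.2).1 / h x.1) ^ (j : ℕ) = 0
          · rw [hz, abs_zero, zero_mul, zero_mul]
          · refine mul_le_mul_of_nonneg_left ?_ (abs_nonneg _)
            have hle := hw.abs_le_of_ne_zero hh hz
            have hmem : (Z i x.2).1 ∈ S := by
              by_contra hc
              rw [hside _ _ hh] at hz
              simp [side, hc] at hz
            refine (htaylor _ hmem (hx2 i) (hle.trans_lt hx1)).trans ?_
            gcongr
      _ = _ := by
          rw [← Finset.sum_mul, hinv]
          simp only [Function.comp_apply]
          ring
  have heq : ∀ᶠ x in probFilter P, empGram K S (h x.1) x.1 (fun i => (Z i x.2).1) *ᵥ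
      (fun j => Real.sqrt (x.1 * h x.1) * (α x.1 x.2 j - c j * h x.1 ^ (j : ℕ))) =
      empScore K S (h x.1) x.1 (fun i => (Z i x.2).1) (fun i => noise κ (Z i x.2)) +
      empScore K S (h x.1) x.1 (fun i => (Z i x.2).1) (bias x) := by
    filter_upwards [hfst.eventually (D.bandwidth_large.eventually_gt_atTop 0)] with x hx
    have hh := D.bandwidth_pos x.1
    refine empGram_mulVec_eq (hα x.1 x.2) (fun y => hside _ y hh) hx fun i => ?_
    have : ∑ k : Fin 3, ((Z i x.2).1 / h x.1) ^ (k : ℕ) * (c k * h x.1 ^ (k : ℕ)) =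
        ∑ k : Fin 3, c k * (Z i x.2).1 ^ (k : ℕ) := by
      refine Finset.sum_congr rfl fun k _ => ?_
      rw [div_pow]
      field_simp
    rw [this, noise, hbias]
    ring
  obtain ⟨h1, h2⟩ := perturbed_linear_system hdet (D.tendsto_empGram hK hS) hB
    (D.stochbounded_score hK hS) heq
  refine ⟨fun j => ?_, by simpa using h2 0⟩
  -- The scaled error is bounded in probability; dividing by `√(nh) → ∞` gives consistency.
  have hinv : Tendsto (fun x : ℕ × Ω => (Real.sqrt (x.1 * h x.1))⁻¹) (probFilter P) (𝓝 0) :=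
    (tendsto_inv_atTop_zero.comp (Real.tendsto_sqrt_atTop.comp D.bandwidth_large)).comp hfst
  refine squeeze_zero_norm' ?_ (h1 _ hinv)
  filter_upwards [hfst.eventually (D.bandwidth_large.eventually_gt_atTop 0)] with x hx
  have hs := Real.sqrt_pos.2 hx
  have h3 := norm_le_pi_norm
    (fun j : Fin 3 => Real.sqrt (x.1 * h x.1) * (α x.1 x.2 j - c j * h x.1 ^ (j : ℕ))) j
  rw [norm_mul, Real.norm_of_nonneg hs.le] at h3
  rwa [← div_eq_inv_mul, le_div_iff₀ hs, mul_comm]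

end LocalDesign

/-- The bandwidth `bw` is kept separate from `h` so that the same construction also serves the
kernel density estimator. -/
lemma AssumptionS.exists_localDesign {Ω : Type*} [MeasurableSpace Ω] {P : Measure Ω}
    {Y X : Ω → ℝ} {Ys Xs : ℕ → Ω → ℝ} {fX : ℝ → ℝ} {a b : ℝ}
    {h bw : ℕ → ℝ} {κ : Kernel ℝ ℝ} [IsMarkovKernel κ] (hκ : HasCondDistrib Y X κ P)
    (hS : AssumptionS P Y X Ys Xs fX a b) (hA : AssumptionSMRD κ a b h)
    (hpos : ∀ n, 0 < bw n) (h0 : Tendsto bw atTop (𝓝 0))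
    (hlarge : Tendsto (fun n : ℕ => (n : ℝ) * bw n) atTop atTop) :
    ∃ δ vr vl, LocalDesign P fX κ (fun i ω => (Xs i ω, Ys i ω)) bw δ vr vl := by
  obtain ⟨ε, hε, hfin, M, hM⟩ := hA.moment
  obtain ⟨vr, hvr, hvr'⟩ := hA.var_right
  obtain ⟨vl, hvl, hvl'⟩ := hA.var_left
  obtain ⟨cr, -, -, hcr, -⟩ := hA.mean_right.exists_taylor_right hS.pos_right
  obtain ⟨cl, -, -, hcl, -⟩ := hA.mean_left.exists_taylor_left hS.neg_left
  have hvar : ∀ x, ∫ y, noise κ (x, y) ^ 2 ∂(κ x) = condVar κ x := fun x => by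
    rw [condVar, variance_eq_integral aemeasurable_id]
    rfl
  -- The moment exponent is capped at `1`, as the bounds on the complex exponential require `δ ≤ 1`.
  refine ⟨min ε 1, vr, vl, ?_, hS.density_measurable, hS.density_nonneg,
    hS.density_smooth.continuousOn.continuousAt (Icc_mem_nhds hS.neg_left hS.pos_right),
    hS.density_pos, hpos, h0, hlarge, lt_min hε one_pos, min_le_right _ _, ?_, ?_,
    by simpa only [hvar] using hvr', by simpa only [hvar] using hvl', hvr, hvl⟩
  · refine ⟨hS.indep.comp (fun _ => Prod.swap) fun _ => measurable_swap, fun i => ?_⟩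
    have h1 := (hS.copies i).comp measurable_swap
    refine ⟨h1.aemeasurable_fst, ?_⟩
    rw [jointLaw, ← hS.density.map_eq, ← hκ.map_eq]
    exact h1.map_eq
  · have hY : CondBounded κ fun z => |z.2| ^ (2 + ε) := by
      refine ⟨M, hM.mono fun x hx => ?_⟩
      refine le_of_eq_of_le (lintegral_congr fun y => ?_) hx
      rw [Real.enorm_eq_ofReal_abs, abs_of_nonneg (by positivity)]
    have hY' := hY.of_rpow (g := fun z => z.2) (by positivity : (0 : ℝ) ≤ 2 + min ε 1)
      (by linarith [min_le_left ε 1])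
    set q := 2 + min ε 1 with hq
    have hq0 : 0 < q := by positivity
    -- The conditional mean has one-sided limits, so it is bounded by `B` near the cutoff, and
    -- moments of the outcome carry over to the noise.
    set B : ℝ≥0 := ⟨|cr 0| + |cl 0| + 1, by positivity⟩ with hB
    have hBv : (B : ℝ) = |cr 0| + |cl 0| + 1 := rfl
    have hbound : ∀ᶠ x in 𝓝[≠] (0 : ℝ), |condMean κ x| ≤ B := by
      rw [← nhdsLT_sup_nhdsGT, eventually_sup]
      constructor
      · filter_upwards [hcl.abs.eventually (gt_mem_nhds (lt_add_one |cl 0|))] with x hx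
        linarith [abs_nonneg (cr 0)]
      · filter_upwards [hcr.abs.eventually (gt_mem_nhds (lt_add_one |cr 0|))] with x hx
        linarith [abs_nonneg (cl 0)]
    refine hY'.mono (2 ^ q * (1 + B ^ q)) (hbound.mono fun x hx y => ?_)
    have e1 : |noise κ (x, y)| ≤ 2 * max |y| B := by
      have := abs_sub y (condMean κ x)
      rw [noise]
      linarith [le_max_left |y| (B : ℝ), le_max_right |y| (B : ℝ)]
    have e2 : (max |y| B : ℝ) ^ q ≤ |y| ^ q + (B : ℝ) ^ q := by
      rcases max_choice |y| (B : ℝ) with h | h <;> rw [h]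
      · linarith [Real.rpow_nonneg B.coe_nonneg q]
      · linarith [Real.rpow_nonneg (abs_nonneg y) q]
    rw [abs_of_nonneg (Real.rpow_nonneg (abs_nonneg _) q),
      abs_of_nonneg (Real.rpow_nonneg (abs_nonneg _) q)]
    push_cast
    calc |noise κ (x, y)| ^ q ≤ (2 * max |y| B) ^ q :=
          Real.rpow_le_rpow (abs_nonneg _) e1 hq0.le
      _ = 2 ^ q * (max |y| B : ℝ) ^ q := Real.mul_rpow zero_le_two (by positivity)
      _ ≤ 2 ^ q * (|y| ^ q + (B : ℝ) ^ q) := by gcongr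
      _ ≤ 2 ^ q * ((1 + (B : ℝ) ^ q) * (1 + |y| ^ q)) := by
          gcongr
          nlinarith [Real.rpow_nonneg B.coe_nonneg q, Real.rpow_nonneg (abs_nonneg y) q,
            mul_nonneg (Real.rpow_nonneg B.coe_nonneg q) (Real.rpow_nonneg (abs_nonneg y) q)]
      _ = _ := by ring
  · have hab : Set.Icc a b \ {0} ∈ 𝓝[≠] (0 : ℝ) := by
      rw [Set.sdiff_eq, Set.inter_comm]
      exact inter_mem_nhdsWithin _ (Icc_mem_nhds hS.neg_left hS.pos_right)
    filter_upwards [hab] with x hx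
    have hint : Integrable (fun y : ℝ => y) (κ x) := by
      have h1 : Integrable (fun y : ℝ => |y| ^ (2 + ε)) (κ x) := by
        refine ⟨(measurable_norm.pow_const (2 + ε)).aestronglyMeasurable, ?_⟩
        refine lt_of_eq_of_lt (lintegral_congr fun y => ?_) (hfin x hx)
        rw [Real.enorm_eq_ofReal_abs, abs_of_nonneg (by positivity)]
      refine ((integrable_const (1 : ℝ)).add h1).mono' measurable_id.aestronglyMeasurable
        (ae_of_all _ fun y => ?_)
      rw [Pi.add_apply, Real.norm_eq_abs]
      rcases le_total |y| 1 with hy | hy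
      · linarith [Real.rpow_nonneg (abs_nonneg y) (2 + ε)]
      · have : |y| ^ (1 : ℝ) ≤ |y| ^ (2 + ε) :=
          Real.rpow_le_rpow_of_exponent_le hy (by linarith)
        rw [Real.rpow_one] at this
        linarith
    simp only [noise]
    rw [integral_sub hint (integrable_const _), integral_const]
    simp [condMean]

/-! ### Asymptotic weights and positivity of the variance -/

/-- The weight of one observation in the one-sided local quadratic estimator of the intercept. -/
def influence (K : ℝ → ℝ) (S : Set ℝ) (u : ℝ) : ℝ :=
  ((kernelMatrix 2 K S)⁻¹ *ᵥ monomials 2 u) 0 * K u * side S u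

/-- The weight of one observation in the estimator of the jump. -/
def contrast (K : ℝ → ℝ) (u : ℝ) : ℝ := influence K (Set.Ici 0) u - influence K (Set.Iic 0) u

lemma influence_eq_sum (K : ℝ → ℝ) (S : Set ℝ) (u : ℝ) :
    influence K S u = ∑ j : Fin 3, (kernelMatrix 2 K S)⁻¹ 0 j * (side S u * K u * u ^ (j : ℕ)) := by
  rw [influence, Matrix.mulVec, dotProduct, Finset.sum_mul, Finset.sum_mul]
  refine Finset.sum_congr rfl fun j _ => ?_
  rw [monomials]
  ring

lemma isLocalWeight_influence {K : ℝ → ℝ} (hK : IsLocalWeight K) {S : Set ℝ}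
    (hS : MeasurableSet S) : IsLocalWeight (influence K S) := by
  have e : influence K S = fun u =>
      (kernelMatrix 2 K S)⁻¹ 0 0 * (side S u * K u * u ^ 0) +
      (kernelMatrix 2 K S)⁻¹ 0 1 * (side S u * K u * u ^ 1) +
      (kernelMatrix 2 K S)⁻¹ 0 2 * (side S u * K u * u ^ 2) := by
    ext u
    rw [influence_eq_sum, Fin.sum_univ_three]
    rfl
  rw [e]
  exact (((hK.sideMoment hS 0).const_mul _).add ((hK.sideMoment hS 1).const_mul _)).add
    ((hK.sideMoment hS 2).const_mul _)

lemma isLocalWeight_contrast {K : ℝ → ℝ} (hK : IsLocalWeight K) : IsLocalWeight (contrast K) :=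
  (isLocalWeight_influence hK measurableSet_Ici).sub (isLocalWeight_influence hK measurableSet_Iic)

lemma kernelMatrix_eq_integral_side {p : ℕ} {K : ℝ → ℝ} {S : Set ℝ} (hS : MeasurableSet S)
    (j k : Fin (p + 1)) :
    kernelMatrix p K S j k = ∫ u, side S u * K u * u ^ ((j : ℕ) + k) := by
  rw [kernelMatrix, Matrix.of_apply, ← integral_indicator hS]
  congr 1
  ext u
  by_cases hu : u ∈ S <;> simp [side, hu, monomials, pow_add]

/-- The moments of the kernel against `1, u, u²` form the first column of `Γ`, so the integral is
the top left entry of `Γ⁻¹ Γ`. -/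
lemma integral_influence {K : ℝ → ℝ} (hK : IsLocalWeight K) {S : Set ℝ} (hS : MeasurableSet S)
    (hΓ : (kernelMatrix 2 K S).PosDef) : ∫ u, influence K S u = 1 := by
  simp_rw [influence_eq_sum]
  rw [integral_finsetSum (f := fun (j : Fin 3) u =>
    (kernelMatrix 2 K S)⁻¹ 0 j * (side S u * K u * u ^ (j : ℕ))) _
    fun j _ => ((hK.sideMoment hS (j : ℕ)).integrable).const_mul _]
  have h1 := congrFun (congrFun (Matrix.nonsing_inv_mul _ hΓ.det_pos.ne'.isUnit) 0) 0
  rw [Matrix.mul_apply, Matrix.one_apply_eq] at h1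
  rw [← h1]
  refine Finset.sum_congr rfl fun j _ => ?_
  rw [integral_const_mul, kernelMatrix_eq_integral_side hS]
  simp

/-- If the integral vanished, `contrast K` would vanish almost everywhere. It equals the right-hand
weight on `(0, ∞)`, whose integral is one. -/
lemma integral_contrast_sq_pos {K : ℝ → ℝ} (hK : AssumptionK 2 K) {w : ℝ → ℝ} (hw : Measurable w)
    (hpos : ∀ u, 0 < w u) {B : ℝ} (hB : ∀ u, w u ≤ B) : 0 < ∫ u, contrast K u ^ 2 * w u := by
  have hψ := isLocalWeight_contrast hK.isLocalWeight
  have hnn : ∀ u, 0 ≤ contrast K u ^ 2 * w u := fun u => mul_nonneg (sq_nonneg _) (hpos u).le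
  refine lt_of_le_of_ne (integral_nonneg hnn) fun h0 => ?_
  have hint : Integrable fun u => contrast K u ^ 2 * w u := by
    have := hψ.sq.mul_bounded hw (B := B) fun u _ => by
      rw [abs_of_pos (hpos u)]; exact hB u
    simpa only [mul_comm] using this.integrable
  rw [eq_comm, integral_eq_zero_iff_of_nonneg hnn hint] at h0
  have h1 : ∫ u, influence K (Set.Ici 0) u = 0 := by
    refine integral_eq_zero_of_ae ?_
    filter_upwards [h0, Measure.ae_ne volume 0] with u hu hu0
    have hc : contrast K u = 0 := by
      have := (mul_eq_zero.1 hu).resolve_right (hpos u).ne'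
      exact pow_eq_zero_iff two_ne_zero |>.1 this
    rcases lt_or_gt_of_ne hu0 with h | h
    · simp [influence, side, not_le.2 h]
    · have h2 : influence K (Set.Iic 0) u = 0 := by simp [influence, side, not_le.2 h]
      rw [contrast, h2, sub_zero] at hc
      exact hc
  rw [integral_influence hK.isLocalWeight measurableSet_Ici hK.posDef_right] at h1
  exact one_ne_zero h1

lemma inv_smul_mulVec_empScore {f₀ : ℝ} (hf : f₀ ≠ 0) {K : ℝ → ℝ} {S : Set ℝ}
    (hΓ : (kernelMatrix 2 K S).PosDef) (h : ℝ) (n : ℕ) (x e : ℕ → ℝ) :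
    ((f₀ • kernelMatrix 2 K S)⁻¹ *ᵥ empScore K S h n x e) 0 =
      (Real.sqrt (n * h))⁻¹ * ∑ i ∈ Finset.range n, f₀⁻¹ * influence K S (x i / h) * e i := by
  have hinv : (f₀ • kernelMatrix 2 K S)⁻¹ = f₀⁻¹ • (kernelMatrix 2 K S)⁻¹ := by
    refine Matrix.inv_eq_right_inv ?_
    rw [Matrix.smul_mul, Matrix.mul_smul, Matrix.mul_nonsing_inv _ hΓ.det_pos.ne'.isUnit, smul_smul,
      mul_inv_cancel₀ hf, one_smul]
  rw [hinv, Matrix.mulVec, dotProduct]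
  simp_rw [influence_eq_sum, empScore, Finset.mul_sum, Finset.sum_mul]
  rw [Finset.sum_comm]
  refine Finset.sum_congr rfl fun i _ => ?_
  rw [Finset.mul_sum]
  refine Finset.sum_congr rfl fun j _ => ?_
  rw [Matrix.smul_apply, smul_eq_mul]
  ring

/-! ### Gaussian multipliers with the data held fixed -/

section

variable {Ξ : Type*} [MeasurableSpace Ξ] {Q : Measure Ξ} {ξ : ℕ → Ξ → ℝ}

/-- Couple the two Gaussians as `s * t` and `σ * t` with the same standard normal `t`; a 1-Lipschitz
test function then changes by at most `|s - σ| * |t|`. -/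
lemma iSup_BL₁_le {T : Ξ → ℝ} {s σ : ℝ≥0} (hT : HasLaw T (gaussianReal 0 (s ^ 2)) Q) :
    ⨆ g : BL₁, |∫ z, g.1 (T z) ∂Q - ∫ t, g.1 t ∂(gaussianReal 0 (σ ^ 2))| ≤
      |(s : ℝ) - σ| * ∫ t, |t| ∂(gaussianReal 0 1) := by
  have hscale : ∀ (r : ℝ≥0) (g : ℝ → ℝ), Continuous g →
      ∫ t, g t ∂(gaussianReal 0 (r ^ 2)) = ∫ t, g (r * t) ∂(gaussianReal 0 1) := fun r g hg => by
    have : gaussianReal 0 (r ^ 2) = (gaussianReal 0 1).map (fun t => (r : ℝ) * t) := by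
      rw [gaussianReal_map_const_mul]
      congr 1
      · simp
      · ext; simp
    rw [this, integral_map (by fun_prop) hg.aestronglyMeasurable]
  refine Real.iSup_le (fun g => ?_) (by positivity)
  obtain ⟨g, hg, hg1⟩ := g
  have hgc := hg.continuous
  have hI : ∀ r : ℝ≥0, Integrable (fun t => g (r * t)) (gaussianReal 0 1) := fun r =>
    Integrable.of_bound (by fun_prop) 1 (ae_of_all _ fun t => hg1 _)
  have hTi : ∫ z, g (T z) ∂Q = ∫ t, g t ∂(gaussianReal 0 (s ^ 2)) :=
    hT.integral_comp hgc.aestronglyMeasurable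
  dsimp only
  rw [hTi, hscale s g hgc, hscale σ g hgc, ← integral_sub (hI s) (hI σ), ← integral_const_mul,
    ← Real.norm_eq_abs]
  have habs : Integrable (fun t : ℝ => |t|) (gaussianReal 0 1) :=
    (memLp_one_iff_integrable.1 (memLp_id_gaussianReal (μ := 0) (v := 1) 1)).abs
  refine norm_integral_le_of_norm_le (habs.const_mul _) (ae_of_all _ fun t => ?_)
  have := hg.dist_le_mul (s * t) (σ * t)
  rw [Real.dist_eq, Real.dist_eq, ← sub_mul, abs_mul, NNReal.coe_one, one_mul] at this
  exact this

variable [IsProbabilityMeasure Q]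

lemma AssumptionM.hasLaw_sum_mul (hM : AssumptionM Q ξ) (c : ℕ → ℝ) (n : ℕ) :
    HasLaw (fun z => ∑ i ∈ Finset.range n, ξ i z * c i)
      (gaussianReal 0 (∑ i ∈ Finset.range n, c i ^ 2).toNNReal) Q := by
  have hl : ∀ i, HasLaw (fun z => ξ i z * c i) (gaussianReal 0 (c i ^ 2).toNNReal) Q := fun i => by
    convert gaussianReal_mul_const (hM.normal i) (c i) using 2
    · simp
    · rw [mul_one]
      exact Real.toNNReal_of_nonneg (sq_nonneg _)
  have hm : AEMeasurable (fun z => ∑ i ∈ Finset.range n, ξ i z * c i) Q :=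
    Finset.aemeasurable_fun_sum _ fun i _ => (hl i).aemeasurable
  have hi : iIndepFun (fun i z => ξ i z * c i) Q :=
    hM.indep.comp (fun i t => t * c i) fun i => measurable_mul_const (c i)
  refine ⟨hm, ?_⟩
  have := Measure.isProbabilityMeasure_map hm
  refine Measure.ext_of_charFun ?_
  rw [(hi.restrict _).charFun_map_fun_finsetSum_eq_prod (X := fun i z => ξ i z * c i)
    fun i _ => (hl i).aemeasurable]
  ext t
  rw [Finset.prod_apply, Finset.prod_congr rfl fun i _ => by rw [(hl i).map_eq]]
  simp_rw [charFun_gaussianReal]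
  rw [← Complex.exp_sum, Real.coe_toNNReal _ (Finset.sum_nonneg fun i _ => sq_nonneg (c i))]
  congr 1
  simp_rw [Real.coe_toNNReal _ (sq_nonneg (c _))]
  push_cast
  simp only [mul_zero, zero_mul, zero_sub, Finset.sum_neg_distrib, ← Finset.sum_div,
    ← Finset.sum_mul]

end

/-- Both sides use the same multiplier for each observation, so the difference is one linear form in
the multipliers with deterministic coefficients given the data. -/
lemma multiplierDiff_eq {Ω Ξ : Type*} {K : ℝ → ℝ} {h : ℕ → ℝ} {Ys Xs : ℕ → Ω → ℝ}
    {ξ : ℕ → Ξ → ℝ} {αr αl : ℕ → Ω → Fin (2 + 1) → ℝ} {f₀ : ℕ → Ω → ℝ} {n : ℕ} (hh : 0 < h n)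
    (ω : Ω) (z : Ξ) :
    multiplierDiff 2 K h Ys Xs ξ αr αl f₀ n ω z = ∑ i ∈ Finset.range n, ξ i z *
      (contrast K (Xs i ω / h n) * (Ys i ω - firstStage (αr n ω) (αl n ω) (h n) (Xs i ω)) /
        (Real.sqrt (n * h n) * f₀ n ω)) := by
  rw [multiplierDiff, multiplierStat, multiplierStat, ← Finset.sum_sub_distrib]
  refine Finset.sum_congr rfl fun i _ => ?_
  rw [contrast, influence, influence, side_Ici_div hh, side_Iic_div hh]
  ring

/-! ### First stage error, limit law of the jump, conditional variance -/

namespace LocalDesign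

variable {Ω : Type*} [MeasurableSpace Ω] {P : Measure Ω} {f : ℝ → ℝ} {κ : Kernel ℝ ℝ}
  {Z : ℕ → Ω → ℝ × ℝ} {h : ℕ → ℝ} {δ vr vl : ℝ}

/-- Uniform consistency of the first stage estimate on the support of the kernel weights. -/
lemma exists_firstStage_error (D : LocalDesign P f κ Z h δ vr vl) {cr cl : Fin 3 → ℝ}
    {Cr Cl r : ℝ} (hr : 0 < r)
    (htr : ∀ x, 0 < x → |x| < r → |condMean κ x - ∑ j, cr j * x ^ (j : ℕ)| ≤ Cr * |x| ^ 3)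
    (htl : ∀ x, x < 0 → |x| < r → |condMean κ x - ∑ j, cl j * x ^ (j : ℕ)| ≤ Cl * |x| ^ 3)
    (hCr : 0 ≤ Cr) (hCl : 0 ≤ Cl) {αr αl : ℕ → Ω → Fin 3 → ℝ}
    (hαr : ∀ j, Tendsto (fun x : ℕ × Ω => αr x.1 x.2 j - cr j * h x.1 ^ (j : ℕ))
      (probFilter P) (𝓝 0))
    (hαl : ∀ j, Tendsto (fun x : ℕ × Ω => αl x.1 x.2 j - cl j * h x.1 ^ (j : ℕ))
      (probFilter P) (𝓝 0)) :
    ∃ E : ℕ × Ω → ℝ, Tendsto E (probFilter P) (𝓝 0) ∧ ∀ᶠ x in probFilter P, ∀ t, t ≠ 0 →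
      |t| ≤ h x.1 → |condMean κ t - firstStage (p := 2) (αr x.1 x.2) (αl x.1 x.2) (h x.1) t| ≤
        E x := by
  have hfst : Tendsto Prod.fst (probFilter P) atTop := tendsto_fst_probFilter
  have hbound : ∀ {c a : Fin 3 → ℝ} {C η t : ℝ}, 0 ≤ C → 0 < η → |t| ≤ η →
      |condMean κ t - ∑ j, c j * t ^ (j : ℕ)| ≤ C * |t| ^ 3 →
      |condMean κ t - monomials 2 (t / η) ⬝ᵥ a| ≤
        C * η ^ 3 + ∑ j, |a j - c j * η ^ (j : ℕ)| := by
    intro c a C η t hC hη ht h1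
    have e : condMean κ t - monomials 2 (t / η) ⬝ᵥ a =
        (condMean κ t - ∑ j, c j * t ^ (j : ℕ)) -
          ∑ j : Fin 3, (t / η) ^ (j : ℕ) * (a j - c j * η ^ (j : ℕ)) := by
      simp only [monomials, dotProduct]
      rw [sub_sub, ← Finset.sum_add_distrib]
      congr 1
      refine Finset.sum_congr rfl fun j _ => ?_
      rw [div_pow]
      field_simp
      ring
    rw [e]
    refine (abs_sub _ _).trans (add_le_add (h1.trans (by gcongr)) ?_)
    refine (Finset.abs_sum_le_sum_abs _ _).trans (Finset.sum_le_sum fun j _ => ?_)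
    rw [abs_mul, abs_pow, abs_div, abs_of_pos hη]
    exact mul_le_of_le_one_left (abs_nonneg _)
      (pow_le_one₀ (by positivity) ((div_le_one hη).2 ht))
  -- Each side contributes its Taylor remainder and its rescaled coefficient errors, since `|t / h|
  -- ≤ 1` on the window. Adding both sides gives one bound valid for either sign of `t`.
  refine ⟨fun x => (Cr * h x.1 ^ 3 + ∑ j, |αr x.1 x.2 j - cr j * h x.1 ^ (j : ℕ)|) +
    (Cl * h x.1 ^ 3 + ∑ j, |αl x.1 x.2 j - cl j * h x.1 ^ (j : ℕ)|), ?_, ?_⟩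
  · have hh : Tendsto (fun x : ℕ × Ω => h x.1 ^ 3) (probFilter P) (𝓝 0) := by
      simpa using ((D.bandwidth_zero.comp hfst).pow 3)
    have h1 := tendsto_finsetSum (Finset.univ : Finset (Fin 3)) fun j _ => (hαr j).abs
    have h2 := tendsto_finsetSum (Finset.univ : Finset (Fin 3)) fun j _ => (hαl j).abs
    simpa using ((hh.const_mul Cr).add h1).add ((hh.const_mul Cl).add h2)
  · filter_upwards [hfst.eventually (D.bandwidth_zero.eventually (gt_mem_nhds hr))] with x hx t ht hth
    have hη := D.bandwidth_pos x.1
    rcases lt_or_gt_of_ne ht with h0 | h0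
    · have := hbound (a := αl x.1 x.2) hCl hη hth (htl t h0 (hth.trans_lt hx))
      have e : firstStage (p := 2) (αr x.1 x.2) (αl x.1 x.2) (h x.1) t =
          monomials 2 (t / h x.1) ⬝ᵥ αl x.1 x.2 := by
        simp [firstStage, side, h0.le, not_le.2 h0]
      rw [e]
      exact this.trans (le_add_of_nonneg_left (by positivity))
    · have := hbound (a := αr x.1 x.2) hCr hη hth (htr t h0 (hth.trans_lt hx))
      have e : firstStage (p := 2) (αr x.1 x.2) (αl x.1 x.2) (h x.1) t =
          monomials 2 (t / h x.1) ⬝ᵥ αr x.1 x.2 := by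
        simp [firstStage, side, h0.le, not_le.2 h0]
      rw [e]
      exact this.trans (le_add_of_nonneg_right (by positivity))

variable [IsProbabilityMeasure P] [IsMarkovKernel κ]

/-- The two linear terms combine into one sum of noise with weight `f(0)⁻¹ * contrast K`, to which
the local central limit theorem applies; the remainder tends to zero in probability, and Slutsky's
theorem concludes. -/
lemma tendstoInDistribution_jump (D : LocalDesign P f κ Z h δ vr vl) {K : ℝ → ℝ}
    (hK : AssumptionK 2 K) {cr cl : ℝ} {αr αl : ℕ → Ω → ℝ} (hαr : ∀ n, AEMeasurable (αr n) P)
    (hαl : ∀ n, AEMeasurable (αl n) P)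
    (hr : Tendsto (fun x : ℕ × Ω => Real.sqrt (x.1 * h x.1) * (αr x.1 x.2 - cr) -
      ((f 0 • kernelMatrix 2 K (Set.Ici 0))⁻¹ *ᵥ empScore K (Set.Ici 0) (h x.1) x.1
        (fun i => (Z i x.2).1) (fun i => noise κ (Z i x.2))) 0) (probFilter P) (𝓝 0))
    (hl : Tendsto (fun x : ℕ × Ω => Real.sqrt (x.1 * h x.1) * (αl x.1 x.2 - cl) -
      ((f 0 • kernelMatrix 2 K (Set.Iic 0))⁻¹ *ᵥ empScore K (Set.Iic 0) (h x.1) x.1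
        (fun i => (Z i x.2).1) (fun i => noise κ (Z i x.2))) 0) (probFilter P) (𝓝 0))
    {v : ℝ≥0} (hv : (f 0)⁻¹ * ∫ u, contrast K u ^ 2 * twoSided vr vl u = v) :
    TendstoInDistribution
      (fun (n : ℕ) ω => Real.sqrt (n * h n) * ((αr n ω - αl n ω) - (cr - cl)))
      atTop (id : ℝ → ℝ) (fun _ => P) (gaussianReal 0 v) := by
  have hf := D.density_pos.ne'
  have hclt := D.clt ((isLocalWeight_contrast hK.isLocalWeight).const_mul (f 0)⁻¹) (v := v) (by
    rw [← hv]
    simp_rw [mul_pow, mul_assoc]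
    rw [integral_const_mul]
    field_simp)
  refine tendstoInDistribution_of_tendstoInMeasure_sub _ _ hclt ?_ fun n =>
    (((hαr n).sub (hαl n)).sub_const _).const_mul _
  refine (tendstoInMeasure_iff_probFilter (c := 0)).2 ?_
  have := hr.sub hl
  rw [sub_zero] at this
  refine this.congr fun x => ?_
  rw [inv_smul_mulVec_empScore hf hK.posDef_right, inv_smul_mulVec_empScore hf hK.posDef_left]
  simp only [Pi.sub_apply, contrast]
  simp_rw [mul_sub, sub_mul, Finset.sum_sub_distrib]
  ring

/-- A residual is noise plus a first stage error `d` with `|d| ≤ E`. Its square differs from the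
squared noise by at most `E * (1 + noise²) + E²`, and local averages of `1` and `noise²` converge.
-/
lemma tendsto_residual_sq (D : LocalDesign P f κ Z h δ vr vl) {ψ : ℝ → ℝ} (hψ : IsLocalWeight ψ)
    {m : ℕ × Ω → ℝ → ℝ} {E : ℕ × Ω → ℝ} (hE : Tendsto E (probFilter P) (𝓝 0))
    (hm : ∀ᶠ x in probFilter P, ∀ t, t ≠ 0 → |t| ≤ h x.1 → |condMean κ t - m x t| ≤ E x) :
    Tendsto (fun x : ℕ × Ω => (x.1 * h x.1)⁻¹ * ∑ i ∈ Finset.range x.1,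
        (ψ ((Z i x.2).1 / h x.1) * ((Z i x.2).2 - m x (Z i x.2).1)) ^ 2)
      (probFilter P) (𝓝 (f 0 * ∫ u, ψ u ^ 2 * twoSided vr vl u)) := by
  have h1 := D.tendsto_weight hψ.sq
  have h2 := D.tendsto_weight_noise_sq hψ.sq
  have h3 : Tendsto (fun x : ℕ × Ω =>
      E x * ((x.1 * h x.1)⁻¹ * ∑ i ∈ Finset.range x.1, ψ ((Z i x.2).1 / h x.1) ^ 2 +
        (x.1 * h x.1)⁻¹ * ∑ i ∈ Finset.range x.1,
          ψ ((Z i x.2).1 / h x.1) ^ 2 * noise κ (Z i x.2) ^ 2) +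
      E x ^ 2 * ((x.1 * h x.1)⁻¹ * ∑ i ∈ Finset.range x.1, ψ ((Z i x.2).1 / h x.1) ^ 2))
      (probFilter P) (𝓝 0) := by
    have := (hE.mul (h1.add h2)).add ((hE.pow 2).mul h1)
    simpa using this
  have h4 : Tendsto (fun x : ℕ × Ω => (x.1 * h x.1)⁻¹ * ∑ i ∈ Finset.range x.1,
        (ψ ((Z i x.2).1 / h x.1) * ((Z i x.2).2 - m x (Z i x.2).1)) ^ 2 -
      (x.1 * h x.1)⁻¹ * ∑ i ∈ Finset.range x.1,
          ψ ((Z i x.2).1 / h x.1) ^ 2 * noise κ (Z i x.2) ^ 2) (probFilter P) (𝓝 0) := by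
    refine squeeze_zero_norm' ?_ h3
    filter_upwards [hm, eventually_probFilter_of_ae (p := fun _ ω => ∀ i, (Z i ω).1 ≠ 0)
      fun _ => D.ae_ne_zero] with x hx hx0
    have hh := D.bandwidth_pos x.1
    have hinv : (0 : ℝ) ≤ (x.1 * h x.1)⁻¹ := inv_nonneg.2 (by positivity)
    have e : E x * ((x.1 * h x.1)⁻¹ * ∑ i ∈ Finset.range x.1, ψ ((Z i x.2).1 / h x.1) ^ 2 +
        (x.1 * h x.1)⁻¹ * ∑ i ∈ Finset.range x.1,
          ψ ((Z i x.2).1 / h x.1) ^ 2 * noise κ (Z i x.2) ^ 2) +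
      E x ^ 2 * ((x.1 * h x.1)⁻¹ * ∑ i ∈ Finset.range x.1, ψ ((Z i x.2).1 / h x.1) ^ 2) =
      (x.1 * h x.1)⁻¹ * ∑ i ∈ Finset.range x.1, ψ ((Z i x.2).1 / h x.1) ^ 2 *
        (E x * (1 + noise κ (Z i x.2) ^ 2) + E x ^ 2) := by
      simp only [mul_add, Finset.mul_sum, ← Finset.sum_add_distrib]
      refine Finset.sum_congr rfl fun i _ => ?_
      ring
    rw [e, ← mul_sub, ← Finset.sum_sub_distrib, norm_mul, Real.norm_of_nonneg hinv]
    refine mul_le_mul_of_nonneg_left ?_ hinv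
    refine (norm_sum_le _ _).trans (Finset.sum_le_sum fun i _ => ?_)
    rw [mul_pow, ← mul_sub, norm_mul, Real.norm_of_nonneg (sq_nonneg _)]
    by_cases hz : ψ ((Z i x.2).1 / h x.1) = 0
    · simp [hz]
    · refine mul_le_mul_of_nonneg_left ?_ (sq_nonneg _)
      have hd := hx _ (hx0 i) (hψ.abs_le_of_ne_zero hh hz)
      set d := condMean κ (Z i x.2).1 - m x (Z i x.2).1 with hd'
      have e2 : (Z i x.2).2 - m x (Z i x.2).1 = noise κ (Z i x.2) + d := by
        rw [noise, hd']; ring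
      set ε := noise κ (Z i x.2)
      have hE0 : 0 ≤ E x := (abs_nonneg d).trans hd
      rw [e2, show (ε + d) ^ 2 - ε ^ 2 = 2 * ε * d + d ^ 2 by ring]
      refine (norm_add_le _ _).trans (add_le_add ?_ ?_)
      · rw [norm_mul, norm_mul, Real.norm_eq_abs, Real.norm_eq_abs, Real.norm_eq_abs, abs_two,
          mul_comm (E x)]
        refine mul_le_mul ?_ hd (abs_nonneg _) (by positivity)
        nlinarith [sq_nonneg (|ε| - 1), sq_abs ε]
      · rw [norm_pow]
        exact pow_le_pow_left₀ (norm_nonneg _) hd 2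
  have := h2.add h4
  rw [add_zero] at this
  exact this.congr fun x => by ring

end LocalDesign

/-- Given the data the statistic is centred Gaussian with variance `V`, the sum of squared
coefficients. The residual average over the squared density estimate is `V`, and it tends to `σ²` in
probability. -/
lemma condWeakConvInProb_multiplierDiff {Ω Ξ : Type*} [MeasurableSpace Ω] [MeasurableSpace Ξ]
    {P : Measure Ω} {Q : Measure Ξ} [IsProbabilityMeasure Q] {ξ : ℕ → Ξ → ℝ}
    (hM : AssumptionM Q ξ) {K : ℝ → ℝ} {h : ℕ → ℝ} (hpos : ∀ n, 0 < h n) {Ys Xs : ℕ → Ω → ℝ}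
    {αr αl : ℕ → Ω → Fin (2 + 1) → ℝ} {fhat : ℕ → Ω → ℝ} {f₀ s₂ : ℝ} (hf₀ : 0 < f₀)
    (hf : Tendsto (fun x : ℕ × Ω => fhat x.1 x.2) (probFilter P) (𝓝 f₀))
    (hres : Tendsto (fun x : ℕ × Ω => (x.1 * h x.1)⁻¹ * ∑ i ∈ Finset.range x.1,
        (contrast K (Xs i x.2 / h x.1) * (Ys i x.2 -
          firstStage (αr x.1 x.2) (αl x.1 x.2) (h x.1) (Xs i x.2))) ^ 2)
      (probFilter P) (𝓝 (f₀ * s₂))) {σ : ℝ≥0} (hσ : f₀⁻¹ * s₂ = (σ : ℝ) ^ 2) :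
    CondWeakConvInProb P Q (multiplierDiff 2 K h Ys Xs ξ αr αl fhat) (gaussianReal 0 (σ ^ 2)) := by
  set c : ℕ × Ω → ℕ → ℝ := fun x i => contrast K (Xs i x.2 / h x.1) * (Ys i x.2 -
    firstStage (αr x.1 x.2) (αl x.1 x.2) (h x.1) (Xs i x.2)) /
      (Real.sqrt (x.1 * h x.1) * fhat x.1 x.2) with hc
  set V : ℕ × Ω → ℝ := fun x => ∑ i ∈ Finset.range x.1, c x i ^ 2 with hV
  have hVlim : Tendsto V (probFilter P) (𝓝 ((σ : ℝ) ^ 2)) := by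
    have h1 := hres.div (hf.pow 2) (pow_pos hf₀ 2).ne'
    have e : f₀ * s₂ / f₀ ^ 2 = (σ : ℝ) ^ 2 := by rw [← hσ]; field_simp
    rw [e] at h1
    refine h1.congr fun x => ?_
    have hn : (0 : ℝ) ≤ x.1 * h x.1 := mul_nonneg (Nat.cast_nonneg _) (hpos _).le
    simp only [hV, hc, Pi.div_apply, div_pow, mul_pow _ (fhat x.1 x.2),
      Real.sq_sqrt hn]
    rw [← Finset.sum_div, ← div_div, div_eq_inv_mul _ ((x.1 : ℝ) * h x.1)]
  have hs : Tendsto (fun x => ((NNReal.sqrt (V x).toNNReal : ℝ≥0) : ℝ)) (probFilter P)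
      (𝓝 (σ : ℝ)) := by
    have h1 := (Real.continuous_sqrt.tendsto _).comp hVlim
    rw [Real.sqrt_sq σ.coe_nonneg] at h1
    refine h1.congr fun x => ?_
    rw [Real.coe_sqrt, Real.coe_toNNReal _ (Finset.sum_nonneg fun i _ => sq_nonneg (c x i))]
    rfl
  rw [CondWeakConvInProb, tendstoInMeasure_iff_probFilter (c := 0)]
  have h2 := ((hs.sub_const (σ : ℝ)).abs).mul_const (∫ t, |t| ∂(gaussianReal 0 1))
  rw [sub_self, abs_zero, zero_mul] at h2
  refine squeeze_zero (fun x => Real.iSup_nonneg fun g => abs_nonneg _) (fun x => ?_) h2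
  refine iSup_BL₁_le ?_
  have hl := hM.hasLaw_sum_mul (c x) x.1
  rw [NNReal.sq_sqrt]
  refine (funext fun z => ?_ : multiplierDiff 2 K h Ys Xs ξ αr αl fhat x.1 x.2 =
    fun z => ∑ i ∈ Finset.range x.1, ξ i z * c x i) ▸ hl
  rw [multiplierDiff_eq (hpos _)]

end

end SharpRD

/-! ### Assembly of the theorem -/

theorem mainTheorem6 {Ω Ξ : Type*} [MeasurableSpace Ω] [MeasurableSpace Ξ]
    (P : Measure Ω) [IsProbabilityMeasure P] (Q : Measure Ξ) [IsProbabilityMeasure Q]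
    (Y X : Ω → ℝ) (Ys Xs : ℕ → Ω → ℝ) (ξ : ℕ → Ξ → ℝ)
    (fX K : ℝ → ℝ) (a b : ℝ) (h : ℕ → ℝ)
    (κ : Kernel ℝ ℝ) [IsMarkovKernel κ] (hκ : HasCondDistrib Y X κ P)
    (hS : SharpRD.AssumptionS P Y X Ys Xs fX a b)
    (hK : SharpRD.AssumptionK 2 K)
    (hM : SharpRD.AssumptionM Q ξ)
    (hSMRD : SharpRD.AssumptionSMRD κ a b h)
    (αr αl : ℕ → Ω → Fin (2 + 1) → ℝ)
    (hr : SharpRD.IsLocalPolyEstimator P Ys Xs 2 K (Set.Ici 0) h αr)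
    (hl : SharpRD.IsLocalPolyEstimator P Ys Xs 2 K (Set.Iic 0) h αl) :
    ∃ τ : ℝ, SharpRD.IsSharpMeanEstimand κ τ ∧
    ∃ σ : ℝ≥0, 0 < σ ∧
      TendstoInDistribution
        (fun (n : ℕ) ω => Real.sqrt (n * h n) * ((αr n ω 0 - αl n ω 0) - τ))
        atTop (id : ℝ → ℝ) (fun _ => P) (gaussianReal 0 (σ ^ 2)) ∧
      (∀ fhat : ℕ → Ω → ℝ, (∀ n, AEMeasurable (fhat n) P) →
        TendstoInMeasure P fhat atTop (fun _ => fX 0) →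
        SharpRD.CondWeakConvInProb P Q (SharpRD.multiplierDiff 2 K h Ys Xs ξ αr αl fhat)
          (gaussianReal 0 (σ ^ 2))) ∧
      (∀ bw : ℕ → ℝ, (∀ n, 0 < bw n) → Tendsto bw atTop (𝓝 0) →
        Tendsto (fun n : ℕ => (n : ℝ) * bw n) atTop atTop → ∫ u, K u = 1 →
        SharpRD.CondWeakConvInProb P Q
          (SharpRD.multiplierDiff 2 K h Ys Xs ξ αr αl (SharpRD.kernelDensityAtZero K bw Xs))
          (gaussianReal 0 (σ ^ 2))) := by
  -- Eventually `h < 1`, so `n * h` dominates `n * h ^ 2`.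
  have hlarge : Tendsto (fun n : ℕ => (n : ℝ) * h n) atTop atTop := by
    refine tendsto_atTop_mono' atTop ?_ hSMRD.bandwidth_two
    filter_upwards [hSMRD.bandwidth_zero.eventually (gt_mem_nhds one_pos)] with n hn
    have := hSMRD.bandwidth_pos n
    gcongr
    nlinarith
  obtain ⟨δ, vr, vl, D⟩ := hS.exists_localDesign hκ hSMRD hSMRD.bandwidth_pos
    hSMRD.bandwidth_zero hlarge
  obtain ⟨cr, Cr, hCr, hcr, htr⟩ := hSMRD.mean_right.exists_taylor_right hS.pos_right
  obtain ⟨cl, Cl, hCl, hcl, htl⟩ := hSMRD.mean_left.exists_taylor_left hS.neg_left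
  set r : ℝ := min b (-a) with hr_def
  have hr0 : 0 < r := lt_min hS.pos_right (neg_pos.2 hS.neg_left)
  have htr' : ∀ x, 0 < x → |x| < r →
      |SharpRD.condMean κ x - ∑ j, cr j * x ^ (j : ℕ)| ≤ Cr * |x| ^ 3 := fun x hx hxr =>
    htr x ⟨hx, (le_abs_self x).trans (hxr.le.trans (min_le_left _ _))⟩
  have htl' : ∀ x, x < 0 → |x| < r →
      |SharpRD.condMean κ x - ∑ j, cl j * x ^ (j : ℕ)| ≤ Cl * |x| ^ 3 := fun x hx hxr =>
    htl x ⟨by linarith [neg_le_abs x, min_le_right b (-a)], hx⟩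
  obtain ⟨hr1, hr2⟩ := D.localPoly hSMRD.bandwidth_seven hK.isLocalWeight measurableSet_Ici
    (fun r x hr => SharpRD.side_Ici_div hr x) hK.posDef_right hCr hr0
    (fun x hx hx0 => htr' x (lt_of_le_of_ne hx hx0.symm)) fun n => (hr n).2
  obtain ⟨hl1, hl2⟩ := D.localPoly hSMRD.bandwidth_seven hK.isLocalWeight measurableSet_Iic
    (fun r x hr => SharpRD.side_Iic_div hr x) hK.posDef_left hCl hr0
    (fun x hx hx0 => htl' x (lt_of_le_of_ne hx hx0)) fun n => (hl n).2
  have hs2 : 0 < ∫ u, SharpRD.contrast K u ^ 2 * SharpRD.twoSided vr vl u :=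
    SharpRD.integral_contrast_sq_pos hK (SharpRD.measurable_twoSided vr vl) D.twoSided_pos
      (B := max vr vl) fun u => by
        rw [SharpRD.twoSided]
        split_ifs
        exacts [le_max_left _ _, le_max_right _ _]
  set s₂ := ∫ u, SharpRD.contrast K u ^ 2 * SharpRD.twoSided vr vl u
  have hv : 0 < (fX 0)⁻¹ * s₂ := mul_pos (inv_pos.2 hS.density_pos) hs2
  set σ : ℝ≥0 := NNReal.sqrt ((fX 0)⁻¹ * s₂).toNNReal with hσ_def
  have hσ : (fX 0)⁻¹ * s₂ = (σ : ℝ) ^ 2 := by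
    rw [hσ_def, ← NNReal.coe_pow, NNReal.sq_sqrt, Real.coe_toNNReal _ hv.le]
  obtain ⟨E, hE, hEm⟩ := D.exists_firstStage_error hr0 htr' htl' hCr hCl hr1 hl1
  have hres := D.tendsto_residual_sq (SharpRD.isLocalWeight_contrast hK.isLocalWeight) hE hEm
  have hboot : ∀ fhat : ℕ → Ω → ℝ, TendstoInMeasure P fhat atTop (fun _ => fX 0) →
      SharpRD.CondWeakConvInProb P Q (SharpRD.multiplierDiff 2 K h Ys Xs ξ αr αl fhat)
        (gaussianReal 0 (σ ^ 2)) := fun fhat hf =>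
    SharpRD.condWeakConvInProb_multiplierDiff hM hSMRD.bandwidth_pos hS.density_pos
      (SharpRD.tendstoInMeasure_iff_probFilter.1 hf) hres hσ
  refine ⟨cr 0 - cl 0, ⟨cr 0, cl 0, hcr, hcl, rfl⟩, σ, NNReal.sqrt_pos.2 (Real.toNNReal_pos.2 hv),
    ?_, fun fhat _ hf => hboot fhat hf, fun bw hbw hbw0 hbwn hK1 => hboot _ ?_⟩
  · refine D.tendstoInDistribution_jump hK (αr := fun n ω => αr n ω 0) (αl := fun n ω => αl n ω 0)
      (fun n => (measurable_pi_apply 0).comp_aemeasurable (hr n).1)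
      (fun n => (measurable_pi_apply 0).comp_aemeasurable (hl n).1) hr2 hl2 ?_
    rw [NNReal.coe_pow]
    exact hσ
  -- The density estimator is the local average of the kernel at bandwidth `bw`; its limit is `fX 0
  -- * ∫ K = fX 0`.
  · obtain ⟨_, _, _, D'⟩ := hS.exists_localDesign hκ hSMRD hbw hbw0 hbwn
    rw [SharpRD.tendstoInMeasure_iff_probFilter]
    have := D'.tendsto_weight hK.isLocalWeight
    rw [hK1, mul_one] at this
    simpa only [SharpRD.kernelDensityAtZero, one_div] using this
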